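/- Let $(M_1,g_1)$ and $(M_2,g_2)$ be smooth finite-dimensional Riemannian manifolds (without boundary; neither connectedness nor completeness is needed), and let $k:M_1\to\mathbb R$ be a smooth function with $\inf_{M_1}k>0$. Put $k_1:=-1/\sup_{M_1}k$ if $k$ is bounded from above and $k_1:=0$ otherwise. On $M_1\times M_2$ consider the semi-Riemannian warped product metric $g:=g_1-k\,g_2$ and, for $r>k_1$, the Riemannian metric $G_r+g_2$, where $G_r:=(\tfrac1k+r)\,g_1$. Let $(\mu,\nu):[0,1]\to M_1\times M_2$ be a geodesic of $G_r+g_2$. A curve $(\gamma,\tau):[0,1]\to M_1\times M_2$ is called a *Riemannian geodesic of $g$ obtained from $(\mu,\nu)$* if it is a geodesic of $g$, $\gamma=\mu\circ\varphi$ and $\tau=\nu\circ\psi$, where $\varphi,\psi$ are diffeomorphisms of $[0,1]$ fixing $0$ and $1$ such that, for some constants $a,b\in\mathbb R$, $$\dot\varphi=a\,\frac{1+rk}{k}\circ\mu\circ\varphi,\qquad \dot\psi=\frac{b}{k\circ\gamma},$$ and $$a^2\,\frac{1+rk(\mu(0))}{k(\mu(0))}\,g_1(\dot\mu(0),\dot\mu(0))=b^2\,g_2(\dot\nu(0),\dot\nu(0)).$$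 **Theorem.** Let $r>k_1$, let $\mu_r:\mathbb R\to M_1$ be a geodesic of $G_r$ whose restriction to $[0,\infty)$ is injective, and let $\nu_r:\mathbb R\to M_2$ be a non-constant geodesic of $g_2$. Then there is a map $\theta_r:\mu_r([0,\infty))\to\nu_r([0,\infty))$ such that: 1. for every $t\ge 0$ there is $\beta\ge 0$ such that the points $(\mu_r(0),\nu_r(0))$ and $(\mu_r(t),\theta_r(\mu_r(t)))$ are joined by a Riemannian geodesic of $g$ obtained from the geodesic $s\mapsto(\mu_r(ts),\nu_r(\beta s))$, $s\in[0,1]$, of $G_r+g_2$; 2. if $k$ is bounded from above, then $\theta_r$ is surjective; 3. if $\nu_r$ is injective on $[0,\infty)$, then $\theta_r$ is injective. In particular, if $k$ is bounded from above and $\nu_r$ is injective on $[0,\infty)$, then $\theta_r$ is a bijection. -/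

import Mathlib

open Set Manifold Bundle
open scoped ContDiff

noncomputable section

namespace RiemGeod

section General

variable {E : Type*} [NormedAddCommGroup E] [NormedSpace ℝ E]
  {H : Type*} [TopologicalSpace H] (I : ModelWithCorners ℝ E H)
  {M : Type*} [TopologicalSpace M] [ChartedSpace H M]

/-- A field of bilinear forms on the tangent spaces of `M`, written as functions of two tangent
vectors. Every field used below is a smooth, symmetric, nondegenerate field of bilinear forms, that
is, a (semi-)Riemannian metric. -/
abbrev Tensor2 (M : Type*) [TopologicalSpace M] [ChartedSpace H M] : Type _ :=
  ∀ x : M, TangentSpace I x → TangentSpace I x → ℝ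

/-- The derivative at `z` of the inverse of the preferred chart around `p`; it maps a vector of the
model space to the tangent vector of `M` that has it as coordinates. -/
def chartFrame (p : M) (z : E) : E →L[ℝ] TangentSpace I ((extChartAt I p).symm z) :=
  mfderiv 𝓘(ℝ, E) I (extChartAt I p).symm z

/-- The coefficient `h_z(v, w)` of the field `g` in the preferred chart around `p`: the value at the
point `z` of the model space of the pull-back of `g` by the inverse chart. -/
def chartMetric (g : Tensor2 I M) (p : M) (z v w : E) : ℝ :=
  g ((extChartAt I p).symm z) (chartFrame I p z v) (chartFrame I p z w)

/-- The directional derivative `(∂_u h)_z(v, w)` of the coefficients of `g`. -/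
def chartMetricDeriv (g : Tensor2 I M) (p : M) (z u v w : E) : ℝ :=
  fderiv ℝ (fun y : E => chartMetric I g p y v w) z u

/-- The Christoffel symbols of the first kind of the Levi-Civita connection of `g` in the chart
around `p`: `Γ_z(u, v; w) = (∂_u h(v, w) + ∂_v h(u, w) - ∂_w h(u, v)) / 2`. -/
def christoffel (g : Tensor2 I M) (p : M) (z u v w : E) : ℝ :=
  (chartMetricDeriv I g p z u v w + chartMetricDeriv I g p z v u w
    - chartMetricDeriv I g p z w u v) / 2

/-- `c` is a (smooth, affinely parametrized) geodesic of `g` on the set `S` of parameters, an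
interval: `∇_{ċ} ċ = 0` on `S`. The equation is written at each parameter `t` in the preferred chart
around `c t`, with the index lowered: for all `w`, `h(ẍ, w) + Γ(ẋ, ẋ; w) = 0`, where `x` is `c` read
in the chart. At the end points of `S` derivatives are one-sided. -/
def IsGeodesicOn (g : Tensor2 I M) (c : ℝ → M) (S : Set ℝ) : Prop :=
  ContMDiffOn 𝓘(ℝ, ℝ) I ∞ c S ∧
  ∀ t ∈ S, ∀ w : E,
    let x : ℝ → E := fun s => extChartAt I (c t) (c s)
    chartMetric I g (c t) (x t) (derivWithin (derivWithin x S) S t) w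
      + christoffel I g (c t) (x t) (derivWithin x S t) (derivWithin x S t) w = 0

/-- The velocity vector `ċ(t)` of a curve defined on the set `S` of parameters. -/
def velocity (c : ℝ → M) (S : Set ℝ) (t : ℝ) : TangentSpace I (c t) :=
  mfderivWithin 𝓘(ℝ, ℝ) I c S t (1 : ℝ)

end General

/-- The field of bilinear forms underlying a smooth Riemannian metric. -/
def ofMetric {E : Type*} [NormedAddCommGroup E] [NormedSpace ℝ E]
    {M : Type*} [TopologicalSpace M] [ChartedSpace E M] [IsManifold 𝓘(ℝ, E) ∞ M]
    (g : ContMDiffRiemannianMetric 𝓘(ℝ, E) ∞ E (fun x : M => TangentSpace 𝓘(ℝ, E) x)) :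
    Tensor2 𝓘(ℝ, E) M :=
  fun x v w => g.inner x v w

section Warped

variable {E₁ : Type*} [NormedAddCommGroup E₁] [NormedSpace ℝ E₁]
  {M₁ : Type*} [TopologicalSpace M₁] [ChartedSpace E₁ M₁]
  {E₂ : Type*} [NormedAddCommGroup E₂] [NormedSpace ℝ E₂]
  {M₂ : Type*} [TopologicalSpace M₂] [ChartedSpace E₂ M₂]

/-- The field `π₁^* h₁ + (f ∘ π₁) π₂^* h₂` on the product manifold `M₁ × M₂`. -/
def warpedSum (h₁ : Tensor2 𝓘(ℝ, E₁) M₁) (f : M₁ → ℝ) (h₂ : Tensor2 𝓘(ℝ, E₂) M₂) :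
    Tensor2 (𝓘(ℝ, E₁).prod 𝓘(ℝ, E₂)) (M₁ × M₂) := fun p v w =>
  h₁ p.1
      (mfderiv (𝓘(ℝ, E₁).prod 𝓘(ℝ, E₂)) 𝓘(ℝ, E₁) (Prod.fst : M₁ × M₂ → M₁) p v)
      (mfderiv (𝓘(ℝ, E₁).prod 𝓘(ℝ, E₂)) 𝓘(ℝ, E₁) (Prod.fst : M₁ × M₂ → M₁) p w)
    + f p.1 * h₂ p.2
      (mfderiv (𝓘(ℝ, E₁).prod 𝓘(ℝ, E₂)) 𝓘(ℝ, E₂) (Prod.snd : M₁ × M₂ → M₂) p v)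
      (mfderiv (𝓘(ℝ, E₁).prod 𝓘(ℝ, E₂)) 𝓘(ℝ, E₂) (Prod.snd : M₁ × M₂ → M₂) p w)

/-- The metric `G_r = (1 / k + r) g₁` on `M₁`. -/
def metricG (g₁ : Tensor2 𝓘(ℝ, E₁) M₁) (k : M₁ → ℝ) (r : ℝ) : Tensor2 𝓘(ℝ, E₁) M₁ :=
  fun x v w => (1 / k x + r) * g₁ x v w

/-- The semi-Riemannian warped product metric `g = g₁ - k g₂` on `M₁ × M₂`. -/
def metricWarped (g₁ : Tensor2 𝓘(ℝ, E₁) M₁) (k : M₁ → ℝ) (g₂ : Tensor2 𝓘(ℝ, E₂) M₂) :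
    Tensor2 (𝓘(ℝ, E₁).prod 𝓘(ℝ, E₂)) (M₁ × M₂) :=
  warpedSum g₁ (fun x => -k x) g₂

/-- The Riemannian metric `G_r + g₂` on `M₁ × M₂`. -/
def metricSum (g₁ : Tensor2 𝓘(ℝ, E₁) M₁) (k : M₁ → ℝ) (r : ℝ) (g₂ : Tensor2 𝓘(ℝ, E₂) M₂) :
    Tensor2 (𝓘(ℝ, E₁).prod 𝓘(ℝ, E₂)) (M₁ × M₂) :=
  warpedSum (metricG g₁ k r) (fun _ => 1) g₂

open Classical in
/-- The threshold `k₁`: it is `-1 / sup k` if `k` is bounded from above, and `0` otherwise. -/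
def threshold (k : M₁ → ℝ) : ℝ :=
  if BddAbove (range k) then -(⨆ x, k x)⁻¹ else 0

/-- `φ` is a smooth bijection of `[0, 1]` fixing `0` and `1`, with derivative `d`.
(For a nowhere vanishing `d` it is a diffeomorphism of `[0, 1]`.) -/
structure IsReparam (φ d : ℝ → ℝ) : Prop where
  smooth : ContDiffOn ℝ ∞ φ (Icc 0 1)
  bijOn : BijOn φ (Icc 0 1) (Icc 0 1)
  zero : φ 0 = 0
  one : φ 1 = 1
  hasDeriv : ∀ s ∈ Icc (0 : ℝ) 1, HasDerivWithinAt φ (d s) (Icc 0 1) s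

/-- `(γ, τ) : [0, 1] → M₁ × M₂` is the Riemannian geodesic of `g = g₁ - k g₂` obtained from the
curve `(μ, ν) : [0, 1] → M₁ × M₂`:
* `(μ, ν)` is a geodesic of `G_r + g₂`;
* `γ = μ ∘ φ`, where `φ' = a (1 + r k) / k ∘ μ ∘ φ` for a constant `a`;
* `τ = ν ∘ ψ`, where `ψ' = b / (k ∘ γ)` for a constant `b`;
* `a² (1 + r k(x₀)) / k(x₀) g₁(μ̇(0), μ̇(0)) = b² g₂(ν̇(0), ν̇(0))`, where `x₀ = μ(0)`;
* `(γ, τ)` is a geodesic of `g`. -/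
def IsRiemannianGeodesicFrom (g₁ : Tensor2 𝓘(ℝ, E₁) M₁) (k : M₁ → ℝ) (g₂ : Tensor2 𝓘(ℝ, E₂) M₂)
    (r : ℝ) (μ : ℝ → M₁) (ν : ℝ → M₂) (γ : ℝ → M₁) (τ : ℝ → M₂) : Prop :=
  IsGeodesicOn (𝓘(ℝ, E₁).prod 𝓘(ℝ, E₂)) (metricSum g₁ k r g₂) (fun s => (μ s, ν s)) (Icc 0 1) ∧
  ∃ (φ ψ : ℝ → ℝ) (a b : ℝ),
    IsReparam φ (fun s => a * ((1 + r * k (μ (φ s))) / k (μ (φ s)))) ∧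
    IsReparam ψ (fun s => b / k (γ s)) ∧
    (∀ s ∈ Icc (0 : ℝ) 1, γ s = μ (φ s)) ∧
    (∀ s ∈ Icc (0 : ℝ) 1, τ s = ν (ψ s)) ∧
    a ^ 2 * ((1 + r * k (μ 0)) / k (μ 0)) *
        g₁ (μ 0) (velocity 𝓘(ℝ, E₁) μ (Icc 0 1) 0) (velocity 𝓘(ℝ, E₁) μ (Icc 0 1) 0)
      = b ^ 2 * g₂ (ν 0) (velocity 𝓘(ℝ, E₂) ν (Icc 0 1) 0) (velocity 𝓘(ℝ, E₂) ν (Icc 0 1) 0) ∧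
    IsGeodesicOn (𝓘(ℝ, E₁).prod 𝓘(ℝ, E₂)) (metricWarped g₁ k g₂) (fun s => (γ s, τ s)) (Icc 0 1)

end Warped

end RiemGeod

end

/-! Write `f = 1 / k + r`. Let `μ` be a geodesic of `f g₁` and `Φ' = A f(μ ∘ Φ)`. The derivative of
`f` along `μ` then cancels, and the `g₁`-acceleration of `γ = μ ∘ Φ` is `(A² / 2) e ∇f = -(A² e /
2k²) ∇k`, where `e = f g₁(μ̇, μ̇)` is the conserved energy. If `ν` is a geodesic of `g₂` and `Ψ' = B
/ k(γ)`, then `τ = ν ∘ Ψ` makes `k τ̇` parallel along `τ` and `g₂(τ̇, τ̇) = B² g₂(ν̇, ν̇) / k²`. The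
geodesic equations of `g₁ - k g₂` ask that `k τ̇` be parallel and that the acceleration of `γ` be
`-(1 / 2) g₂(τ̇, τ̇) ∇k`. Both hold once `A² e = B² g₂(ν̇, ν̇)` (`isGeodesicOn_metricWarped`).

For an end parameter `t`, take `A = t a` and `B = β b`, where `a` and `b` normalize the
reparametrizations to fix `0` and `1`. Substituting `u = φ(s)` in the integral defining `b` shows
that the energy condition holds for `β(t) = ρ ∫₀ᵗ du / (1 + r k(μ u))`, with `ρ` the ratio of the
`G_r`-speed of `μ` to the `g₂`-speed of `ν` (`exists_isRiemannianGeodesicFrom`).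

Put `θ(μ t) = ν(β t)`. The function `β` is strictly increasing with `β 0 = 0`, so injectivity of `ν`
passes to `θ`. If `k` is bounded above, the integrand is bounded below by a positive constant, so
`β` maps `[0, ∞)` onto itself and `θ` is surjective. -/

namespace RiemGeod

open Filter Topology

/-! ### Metric coefficients in a chart and their differentiability. -/

section ChartForm

variable {E : Type*} [NormedAddCommGroup E] [NormedSpace ℝ E]
  {M : Type*} [TopologicalSpace M] [ChartedSpace E M] [IsManifold 𝓘(ℝ, E) ∞ M]

/-- The value of a Riemannian metric at a point, as a bounded bilinear form on the model space. -/
noncomputable def innerForm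
    (g : ContMDiffRiemannianMetric 𝓘(ℝ, E) ∞ E (fun x : M => TangentSpace 𝓘(ℝ, E) x))
    (q : M) : E →L[ℝ] E →L[ℝ] ℝ :=
  g.inner q

/-- The frame of the preferred chart around `p`, as an endomorphism of the model space. -/
noncomputable def frameMap (p : M) (z : E) : E →L[ℝ] E := chartFrame 𝓘(ℝ, E) p z

/-- The coefficients of a Riemannian metric in the preferred chart around `p`, as a bounded bilinear
form on the model space. -/
noncomputable def chartForm
    (g : ContMDiffRiemannianMetric 𝓘(ℝ, E) ∞ E (fun x : M => TangentSpace 𝓘(ℝ, E) x))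
    (p : M) (z : E) : E →L[ℝ] E →L[ℝ] ℝ :=
  (innerForm g ((extChartAt 𝓘(ℝ, E) p).symm z)).bilinearComp (frameMap p z) (frameMap p z)

variable (g : ContMDiffRiemannianMetric 𝓘(ℝ, E) ∞ E (fun x : M => TangentSpace 𝓘(ℝ, E) x))

theorem chartMetric_ofMetric (p : M) (z v w : E) :
    chartMetric 𝓘(ℝ, E) (ofMetric g) p z v w = chartForm g p z v w := by
  rw [chartForm, ContinuousLinearMap.bilinearComp_apply]
  rfl

theorem chartForm_symm (p : M) (z v w : E) : chartForm g p z v w = chartForm g p z w v := by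
  rw [← chartMetric_ofMetric, ← chartMetric_ofMetric]
  exact g.symm _ _ _

theorem contMDiffOn_chartFrame (p : M) (v : E) :
    ContMDiffOn 𝓘(ℝ, E) (𝓘(ℝ, E).prod 𝓘(ℝ, E)) 1
      (fun z : E => (TotalSpace.mk' E ((extChartAt 𝓘(ℝ, E) p).symm z)
        (chartFrame 𝓘(ℝ, E) p z v) : TangentBundle 𝓘(ℝ, E) M)) (extChartAt 𝓘(ℝ, E) p).target := by
  have hopen : IsOpen (extChartAt 𝓘(ℝ, E) p).target := isOpen_extChartAt_target p
  have h1 := (contMDiffOn_extChartAt_symm (I := 𝓘(ℝ, E)) (n := ∞) p).contMDiffOn_tangentMapWithin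
    (m := 1) (by norm_cast) hopen.uniqueMDiffOn
  have h2 : ContMDiff 𝓘(ℝ, E) 𝓘(ℝ, E).tangent 1
      (fun z : E => (TotalSpace.mk' E z (v : TangentSpace 𝓘(ℝ, E) z) :
        TangentBundle 𝓘(ℝ, E) E)) :=
    contMDiff_vectorSpace_iff_contDiff.2 contDiff_const
  have h3 := h1.comp (I := 𝓘(ℝ, E)) h2.contMDiffOn
    (s := (extChartAt 𝓘(ℝ, E) p).target) (fun z hz => hz)
  refine h3.congr fun z hz => ?_
  simp only [Function.comp, tangentMapWithin, chartFrame]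
  rw [mfderivWithin_of_isOpen hopen hz]
  rfl

theorem contDiffOn_chartForm [FiniteDimensional ℝ E] (p : M) :
    ContDiffOn ℝ 1 (chartForm g p) (extChartAt 𝓘(ℝ, E) p).target := by
  rw [contDiffOn_clm_apply]
  intro v
  rw [contDiffOn_clm_apply]
  intro w
  rw [← contMDiffOn_iff_contDiffOn]
  have hg : ContMDiffOn 𝓘(ℝ, E) (𝓘(ℝ, E).prod 𝓘(ℝ, E →L[ℝ] E →L[ℝ] ℝ)) 1
      (fun z : E => TotalSpace.mk' (E →L[ℝ] E →L[ℝ] ℝ)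
        (E := fun x : M => TangentSpace 𝓘(ℝ, E) x →L[ℝ] TangentSpace 𝓘(ℝ, E) x →L[ℝ] ℝ)
        ((extChartAt 𝓘(ℝ, E) p).symm z) (g.inner ((extChartAt 𝓘(ℝ, E) p).symm z)))
      (extChartAt 𝓘(ℝ, E) p).target :=
    (g.contMDiff.of_le (by norm_num)).comp_contMDiffOn
      ((contMDiffOn_extChartAt_symm (I := 𝓘(ℝ, E)) (n := ∞) p).of_le (by norm_num))
  have h := ContMDiffOn.clm_bundle_apply₂ (F₃ := ℝ) (E₃ := Bundle.Trivial M ℝ) hg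
    (contMDiffOn_chartFrame p v) (contMDiffOn_chartFrame p w)
  intro z hz
  have := h z hz
  simp only [contMDiffWithinAt_totalSpace] at this
  exact this.2

theorem differentiableAt_chartForm [FiniteDimensional ℝ E] (p : M) {z : E}
    (hz : z ∈ (extChartAt 𝓘(ℝ, E) p).target) : DifferentiableAt ℝ (chartForm g p) z :=
  ((contDiffOn_chartForm g p).contDiffAt
    ((isOpen_extChartAt_target p).mem_nhds hz)).differentiableAt (by norm_num)

theorem chartMetricDeriv_ofMetric [FiniteDimensional ℝ E] (p : M) {z : E}
    (hz : z ∈ (extChartAt 𝓘(ℝ, E) p).target) (u v w : E) :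
    chartMetricDeriv 𝓘(ℝ, E) (ofMetric g) p z u v w = fderiv ℝ (chartForm g p) z u v w := by
  have h := (differentiableAt_chartForm g p hz).hasFDerivAt
  have h1 := (h.clm_apply (hasFDerivAt_const v z)).clm_apply (hasFDerivAt_const w z)
  unfold chartMetricDeriv
  simp only [chartMetric_ofMetric]
  rw [h1.fderiv]
  simp

end ChartForm

/-! ### Charts and warped metrics on a product. -/

section Product

variable {E₁ : Type*} [NormedAddCommGroup E₁] [NormedSpace ℝ E₁]
  {M₁ : Type*} [TopologicalSpace M₁] [ChartedSpace E₁ M₁]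
  {E₂ : Type*} [NormedAddCommGroup E₂] [NormedSpace ℝ E₂]
  {M₂ : Type*} [TopologicalSpace M₂] [ChartedSpace E₂ M₂]

theorem extChartAt_prod_apply (p : M₁ × M₂) (q : M₁ × M₂) :
    extChartAt (𝓘(ℝ, E₁).prod 𝓘(ℝ, E₂)) p q
      = (extChartAt 𝓘(ℝ, E₁) p.1 q.1, extChartAt 𝓘(ℝ, E₂) p.2 q.2) := by
  rw [extChartAt_prod]; rfl

theorem extChartAt_prod_symm_apply (p : M₁ × M₂) (z : E₁ × E₂) :
    (extChartAt (𝓘(ℝ, E₁).prod 𝓘(ℝ, E₂)) p).symm z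
      = ((extChartAt 𝓘(ℝ, E₁) p.1).symm z.1, (extChartAt 𝓘(ℝ, E₂) p.2).symm z.2) := by
  rw [extChartAt_prod]; rfl

/-- `E₁ × E₂` carries two formally different models, the product of the two factors' models and its
own. `chartFrame` differentiates with respect to the latter, while `prodMap` produces the former. -/
theorem hasMFDerivAt_modelSelf_prod {f : E₁ × E₂ → M₁ × M₂} {z : E₁ × E₂}
    {D : E₁ × E₂ →L[ℝ] E₁ × E₂}
    (h : HasMFDerivAt (𝓘(ℝ, E₁).prod 𝓘(ℝ, E₂)) (𝓘(ℝ, E₁).prod 𝓘(ℝ, E₂)) f z D) :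
    HasMFDerivAt 𝓘(ℝ, E₁ × E₂) (𝓘(ℝ, E₁).prod 𝓘(ℝ, E₂)) f z D := by
  refine ⟨h.1, ?_⟩
  have h2 := h.2
  simp only [mfld_simps, prodChartedSpace_chartAt, chartAt_self_eq, Prod.map_id, range_id] at h2 ⊢
  exact h2

variable [IsManifold 𝓘(ℝ, E₁) ∞ M₁] [IsManifold 𝓘(ℝ, E₂) ∞ M₂]

theorem chartFrame_prod (p : M₁ × M₂) {z : E₁ × E₂}
    (h₁ : z.1 ∈ (extChartAt 𝓘(ℝ, E₁) p.1).target) (h₂ : z.2 ∈ (extChartAt 𝓘(ℝ, E₂) p.2).target)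
    (v : E₁ × E₂) :
    (chartFrame (𝓘(ℝ, E₁).prod 𝓘(ℝ, E₂)) p z v : E₁ × E₂)
      = ((chartFrame 𝓘(ℝ, E₁) p.1 z.1 v.1 : E₁), (chartFrame 𝓘(ℝ, E₂) p.2 z.2 v.2 : E₂)) := by
  have d₁ : MDifferentiableAt 𝓘(ℝ, E₁) 𝓘(ℝ, E₁) (extChartAt 𝓘(ℝ, E₁) p.1).symm z.1 :=
    ((contMDiffOn_extChartAt_symm (I := 𝓘(ℝ, E₁)) (n := ∞) p.1).contMDiffAt
      ((isOpen_extChartAt_target p.1).mem_nhds h₁)).mdifferentiableAt (by norm_num)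
  have d₂ : MDifferentiableAt 𝓘(ℝ, E₂) 𝓘(ℝ, E₂) (extChartAt 𝓘(ℝ, E₂) p.2).symm z.2 :=
    ((contMDiffOn_extChartAt_symm (I := 𝓘(ℝ, E₂)) (n := ∞) p.2).contMDiffAt
      ((isOpen_extChartAt_target p.2).mem_nhds h₂)).mdifferentiableAt (by norm_num)
  have key := (d₁.hasMFDerivAt.prodMap d₂.hasMFDerivAt)
  have heq : ((extChartAt (𝓘(ℝ, E₁).prod 𝓘(ℝ, E₂)) p).symm : E₁ × E₂ → M₁ × M₂)
      = Prod.map (extChartAt 𝓘(ℝ, E₁) p.1).symm (extChartAt 𝓘(ℝ, E₂) p.2).symm := by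
    funext y; exact extChartAt_prod_symm_apply p y
  have hd := hasMFDerivAt_modelSelf_prod (key.congr_of_eventuallyEq (Filter.EventuallyEq.of_eq heq))
  have := hd.mfderiv
  exact congrArg (fun L : E₁ × E₂ →L[ℝ] E₁ × E₂ => L v) this

theorem chartMetric_warpedSum (h₁ : Tensor2 𝓘(ℝ, E₁) M₁) (f : M₁ → ℝ) (h₂ : Tensor2 𝓘(ℝ, E₂) M₂)
    (p : M₁ × M₂) {z : E₁ × E₂}
    (hz₁ : z.1 ∈ (extChartAt 𝓘(ℝ, E₁) p.1).target) (hz₂ : z.2 ∈ (extChartAt 𝓘(ℝ, E₂) p.2).target)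
    (v w : E₁ × E₂) :
    chartMetric (𝓘(ℝ, E₁).prod 𝓘(ℝ, E₂)) (warpedSum h₁ f h₂) p z v w
      = chartMetric 𝓘(ℝ, E₁) h₁ p.1 z.1 v.1 w.1
        + f ((extChartAt 𝓘(ℝ, E₁) p.1).symm z.1) * chartMetric 𝓘(ℝ, E₂) h₂ p.2 z.2 v.2 w.2 := by
  have e := extChartAt_prod_symm_apply p z
  have hv := chartFrame_prod p hz₁ hz₂ v
  have hw := chartFrame_prod p hz₁ hz₂ w
  -- The vectors live in spaces depending on the base point, so points and vectors are generalized
  -- and substituted together.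
  have aux : ∀ (q : M₁ × M₂) (q₁ : M₁) (q₂ : M₂) (a b : E₁ × E₂) (a₁ b₁ : E₁) (a₂ b₂ : E₂),
      q = (q₁, q₂) → a = (a₁, a₂) → b = (b₁, b₂) →
      warpedSum h₁ f h₂ q a b = h₁ q₁ a₁ b₁ + f q₁ * h₂ q₂ a₂ b₂ := by
    rintro q q₁ q₂ a b a₁ b₁ a₂ b₂ rfl rfl rfl
    simp only [warpedSum, mfderiv_fst, mfderiv_snd]
    rfl
  exact aux _ _ _ _ _ _ _ _ _ e hv hw

end Product

/-! ### First and second derivatives along curves. -/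

section Calculus

variable {E : Type*} [NormedAddCommGroup E] [NormedSpace ℝ E]

theorem differentiableAt_deriv_of_contDiffAt {x : ℝ → E} {t : ℝ} (hx : ContDiffAt ℝ 2 x t) :
    DifferentiableAt ℝ (deriv x) t := by
  have h : ContDiffAt ℝ 1 (fun s => fderiv ℝ x s 1) t :=
    (hx.fderiv_right (m := 1) (by norm_num)).clm_apply contDiffAt_const
  exact h.differentiableAt (by norm_num)

theorem eventually_differentiableAt_of_contDiffAt {x : ℝ → E} {t : ℝ} (hx : ContDiffAt ℝ 2 x t) :
    ∀ᶠ s in 𝓝 t, DifferentiableAt ℝ x s :=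
  (hx.eventually (by simp)).mono fun _ hs => hs.differentiableAt (by norm_num)

/-- Every curve constructed below is smooth on all of `ℝ`, so the one-sided derivatives in
`IsGeodesicOn` are ordinary ones. -/
theorem derivWithin_derivWithin_eq {x : ℝ → E} {S : Set ℝ} (hS : UniqueDiffOn ℝ S) {t : ℝ}
    (ht : t ∈ S) (hx : ContDiffAt ℝ 2 x t) :
    derivWithin (derivWithin x S) S t = deriv (deriv x) t := by
  have h1 : derivWithin x S =ᶠ[𝓝[S] t] deriv x := by
    filter_upwards [nhdsWithin_le_nhds (eventually_differentiableAt_of_contDiffAt hx),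
      self_mem_nhdsWithin] with s hs hsS
    exact hs.derivWithin (hS s hsS)
  rw [h1.derivWithin_eq_of_mem ht]
  exact (differentiableAt_deriv_of_contDiffAt hx).derivWithin (hS t ht)

theorem deriv_comp_reparam {y : ℝ → E} {Φ : ℝ → ℝ} {s : ℝ} (hy : ContDiffAt ℝ 2 y (Φ s))
    (hΦ : ContDiff ℝ 2 Φ) :
    deriv (fun s => y (Φ s)) s = deriv Φ s • deriv y (Φ s) ∧
    deriv (deriv (fun s => y (Φ s))) s
      = deriv (deriv Φ) s • deriv y (Φ s) + (deriv Φ s) ^ 2 • deriv (deriv y) (Φ s) := by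
  have hΦd : Differentiable ℝ Φ := hΦ.differentiable (by norm_num)
  have h1 : ∀ᶠ σ in 𝓝 s, deriv (fun s => y (Φ s)) σ = deriv Φ σ • deriv y (Φ σ) := by
    have := (hΦ.continuous.tendsto s).eventually (eventually_differentiableAt_of_contDiffAt hy)
    filter_upwards [this] with σ hσ
    exact (hσ.hasDerivAt.scomp σ (hΦd σ).hasDerivAt).deriv
  refine ⟨h1.self_of_nhds, ?_⟩
  rw [EventuallyEq.deriv_eq h1]
  have h2 := (differentiableAt_deriv_of_contDiffAt hΦ.contDiffAt (t := s)).hasDerivAt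
  have h3 := (differentiableAt_deriv_of_contDiffAt hy).hasDerivAt.scomp s (hΦd s).hasDerivAt
  have h4 := (h2.smul h3).deriv
  simp only [Function.comp_def, Pi.smul_def'] at h4
  rw [h4, smul_smul, pow_two, add_comm]

theorem fderiv_one_div_add {K : E → ℝ} {z : E}
    (hK : DifferentiableAt ℝ K z) (h0 : K z ≠ 0) (r : ℝ) (w : E) :
    fderiv ℝ (fun y => 1 / K y + r) z w = -fderiv ℝ K z w / K z ^ 2 := by
  have h : HasDerivAt (fun y : ℝ => 1 / y + r) (-(K z ^ 2)⁻¹) (K z) := by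
    simpa only [one_div] using (hasDerivAt_inv h0).add_const r
  have h2 := (h.comp_hasFDerivAt z hK.hasFDerivAt).fderiv
  simp only [Function.comp_def] at h2
  rw [h2]
  simp [div_eq_mul_inv]
  ring

end Calculus

/-! ### Curves in charts and their speed. -/

section Curve

variable {E : Type*} [NormedAddCommGroup E] [NormedSpace ℝ E]
  {M : Type*} [TopologicalSpace M] [ChartedSpace E M]

theorem eventually_mem_source {c : ℝ → M} (hc : ContMDiff 𝓘(ℝ, ℝ) 𝓘(ℝ, E) ∞ c) (p : M) {t : ℝ}
    (ht : c t ∈ (extChartAt 𝓘(ℝ, E) p).source) :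
    ∀ᶠ s in 𝓝 t, c s ∈ (extChartAt 𝓘(ℝ, E) p).source :=
  hc.continuous.continuousAt.eventually ((isOpen_extChartAt_source p).mem_nhds ht)

variable [IsManifold 𝓘(ℝ, E) ∞ M]

theorem contDiffAt_chart_curve {c : ℝ → M} (hc : ContMDiff 𝓘(ℝ, ℝ) 𝓘(ℝ, E) ∞ c) (p : M) {t : ℝ}
    (ht : c t ∈ (extChartAt 𝓘(ℝ, E) p).source) :
    ContDiffAt ℝ ∞ (fun s => extChartAt 𝓘(ℝ, E) p (c s)) t := by
  rw [← contMDiffAt_iff_contDiffAt]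
  have h := contMDiffAt_extChartAt' (I := 𝓘(ℝ, E)) (n := ∞) (x := p) (x' := c t)
    (by simpa using ht)
  exact h.comp t hc.contMDiffAt

theorem differentiableAt_comp_chart_symm {F : M → ℝ} (hF : ContMDiff 𝓘(ℝ, E) 𝓘(ℝ, ℝ) ∞ F) (p : M)
    {z : E} (hz : z ∈ (extChartAt 𝓘(ℝ, E) p).target) :
    DifferentiableAt ℝ (fun y => F ((extChartAt 𝓘(ℝ, E) p).symm y)) z := by
  have h := (hF.comp_contMDiffOn (contMDiffOn_extChartAt_symm (I := 𝓘(ℝ, E)) (n := ∞) p)).contMDiffAt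
    ((isOpen_extChartAt_target p).mem_nhds hz)
  exact (contMDiffAt_iff_contDiffAt.1 h).differentiableAt (by norm_num)

theorem hasDerivAt_comp_curve {F : M → ℝ} (hF : ContMDiff 𝓘(ℝ, E) 𝓘(ℝ, ℝ) ∞ F) {c : ℝ → M}
    (hc : ContMDiff 𝓘(ℝ, ℝ) 𝓘(ℝ, E) ∞ c) (p : M) {t : ℝ}
    (ht : c t ∈ (extChartAt 𝓘(ℝ, E) p).source) :
    HasDerivAt (fun s => F (c s))
      (fderiv ℝ (fun y => F ((extChartAt 𝓘(ℝ, E) p).symm y)) (extChartAt 𝓘(ℝ, E) p (c t))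
        (deriv (fun s => extChartAt 𝓘(ℝ, E) p (c s)) t)) t := by
  have h1 := (differentiableAt_comp_chart_symm hF p
    ((extChartAt 𝓘(ℝ, E) p).map_source ht)).hasFDerivAt
  have h2 := ((contDiffAt_chart_curve hc p ht).differentiableAt (by norm_num)).hasDerivAt
  refine (h1.comp_hasDerivAt t h2).congr_of_eventuallyEq ?_
  filter_upwards [eventually_mem_source hc p ht] with s hs
  exact congrArg F ((extChartAt 𝓘(ℝ, E) p).left_inv hs).symm

variable (g : ContMDiffRiemannianMetric 𝓘(ℝ, E) ∞ E (fun x : M => TangentSpace 𝓘(ℝ, E) x))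

/-- The squared speed of a curve. -/
noncomputable def speedSq (c : ℝ → M) (t : ℝ) : ℝ :=
  ofMetric g (c t) (velocity 𝓘(ℝ, E) c univ t) (velocity 𝓘(ℝ, E) c univ t)

theorem chartFrame_deriv_chart {c : ℝ → M} (hc : ContMDiff 𝓘(ℝ, ℝ) 𝓘(ℝ, E) ∞ c) (p : M) {t : ℝ}
    (ht : c t ∈ (extChartAt 𝓘(ℝ, E) p).source) :
    (chartFrame 𝓘(ℝ, E) p (extChartAt 𝓘(ℝ, E) p (c t))
      (deriv (fun s => extChartAt 𝓘(ℝ, E) p (c s)) t) : E)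
      = (velocity 𝓘(ℝ, E) c univ t : E) := by
  have d₁ : MDifferentiableAt 𝓘(ℝ, E) 𝓘(ℝ, E) (extChartAt 𝓘(ℝ, E) p).symm
      (extChartAt 𝓘(ℝ, E) p (c t)) :=
    ((contMDiffOn_extChartAt_symm (I := 𝓘(ℝ, E)) (n := ∞) p).contMDiffAt
      ((isOpen_extChartAt_target p).mem_nhds
        ((extChartAt 𝓘(ℝ, E) p).map_source ht))).mdifferentiableAt (by norm_num)
  have d₂ : DifferentiableAt ℝ (fun s => extChartAt 𝓘(ℝ, E) p (c s)) t :=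
    (contDiffAt_chart_curve hc p ht).differentiableAt (by norm_num)
  have h := d₁.hasMFDerivAt.comp t d₂.hasFDerivAt.hasMFDerivAt
  have heq : (fun s => c s) =ᶠ[𝓝 t]
      ((extChartAt 𝓘(ℝ, E) p).symm ∘ fun s => extChartAt 𝓘(ℝ, E) p (c s)) := by
    filter_upwards [eventually_mem_source hc p ht] with s hs
    exact ((extChartAt 𝓘(ℝ, E) p).left_inv hs).symm
  have h2 := (h.congr_of_eventuallyEq heq).mfderiv
  unfold velocity
  rw [mfderivWithin_univ]
  have h3 := congrArg (fun L : ℝ →L[ℝ] E => L 1) h2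
  exact h3.symm

theorem speedSq_eq_chartForm {c : ℝ → M} (hc : ContMDiff 𝓘(ℝ, ℝ) 𝓘(ℝ, E) ∞ c) (p : M) {t : ℝ}
    (ht : c t ∈ (extChartAt 𝓘(ℝ, E) p).source) :
    speedSq g c t = chartForm g p (extChartAt 𝓘(ℝ, E) p (c t))
      (deriv (fun s => extChartAt 𝓘(ℝ, E) p (c s)) t)
      (deriv (fun s => extChartAt 𝓘(ℝ, E) p (c s)) t) := by
  have aux : ∀ (q q' : M) (v v' : E), q' = q → v' = v → ofMetric g q v v = ofMetric g q' v' v' := by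
    rintro q _ v _ rfl rfl; rfl
  rw [← chartMetric_ofMetric]
  exact aux _ _ _ _ ((extChartAt 𝓘(ℝ, E) p).left_inv ht) (chartFrame_deriv_chart hc p ht)

theorem ofMetric_velocity {c : ℝ → M} (hc : ContMDiff 𝓘(ℝ, ℝ) 𝓘(ℝ, E) ∞ c) {S : Set ℝ}
    (hS : UniqueDiffOn ℝ S) {t : ℝ} (ht : t ∈ S) :
    ofMetric g (c t) (velocity 𝓘(ℝ, E) c S t) (velocity 𝓘(ℝ, E) c S t) = speedSq g c t := by
  have : velocity 𝓘(ℝ, E) c S t = velocity 𝓘(ℝ, E) c univ t := by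
    unfold velocity
    rw [mfderivWithin_eq_mfderiv (uniqueMDiffWithinAt_iff_uniqueDiffWithinAt.2 (hS t ht))
      (hc.mdifferentiableAt (by norm_num)), mfderivWithin_univ]
  rw [speedSq, this]

theorem speedSq_comp {c : ℝ → M} (hc : ContMDiff 𝓘(ℝ, ℝ) 𝓘(ℝ, E) ∞ c) {Φ : ℝ → ℝ}
    (hΦ : ContDiff ℝ ∞ Φ) (s : ℝ) :
    speedSq g (fun s => c (Φ s)) s = deriv Φ s ^ 2 * speedSq g c (Φ s) := by
  have hcΦ : ContMDiff 𝓘(ℝ, ℝ) 𝓘(ℝ, E) ∞ (fun s => c (Φ s)) := hc.comp hΦ.contMDiff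
  have hs := mem_extChartAt_source (I := 𝓘(ℝ, E)) (c (Φ s))
  rw [speedSq_eq_chartForm g hcΦ (c (Φ s)) hs, speedSq_eq_chartForm g hc (c (Φ s)) hs]
  have := (deriv_comp_reparam (y := fun s' => extChartAt 𝓘(ℝ, E) (c (Φ s)) (c s')) (Φ := Φ) (s := s)
    ((contDiffAt_chart_curve hc _ hs).of_le (by norm_cast))
    (hΦ.of_le (by norm_cast))).1
  rw [this]
  simp only [map_smul, smul_apply, smul_eq_mul]
  ring

/-- Positive definiteness turns zero speed into zero velocity. The curve is then constant in a chart
on a small ball of parameters, and `ℝ` is connected. -/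
theorem eq_of_speedSq_eq_zero {c : ℝ → M} (hc : ContMDiff 𝓘(ℝ, ℝ) 𝓘(ℝ, E) ∞ c)
    (h : ∀ t, speedSq g c t = 0) (s t : ℝ) : c s = c t := by
  have hvel : ∀ t, (velocity 𝓘(ℝ, E) c univ t : TangentSpace 𝓘(ℝ, E) (c t)) = 0 := by
    intro t
    by_contra hne
    exact (g.pos (c t) _ hne).ne' (h t)
  have hloc : IsLocallyConstant c := by
    rw [IsLocallyConstant.iff_eventually_eq]
    intro t
    have ht := mem_extChartAt_source (I := 𝓘(ℝ, E)) (c t)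
    have hev := eventually_mem_source hc (c t) ht
    obtain ⟨ε, hε, hball⟩ := Metric.eventually_nhds_iff_ball.1 hev
    have hder : ∀ s ∈ Metric.ball t ε,
        HasDerivAt (fun s => extChartAt 𝓘(ℝ, E) (c t) (c s)) 0 s := by
      intro s hs
      have hm : mfderiv 𝓘(ℝ, ℝ) 𝓘(ℝ, E) c s = 0 := by
        have h0 := hvel s
        unfold velocity at h0
        rw [mfderivWithin_univ] at h0
        exact ContinuousLinearMap.ext_ring (R₁ := ℝ) (M₁ := E) h0
      have hm' : HasMFDerivAt 𝓘(ℝ, ℝ) 𝓘(ℝ, E) c s 0 :=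
        hm ▸ (hc.mdifferentiableAt (by norm_num)).hasMFDerivAt
      have hch := (contMDiffAt_extChartAt' (I := 𝓘(ℝ, E)) (n := ∞) (x := c t) (x' := c s)
        (by simpa using hball s hs)).mdifferentiableAt (by norm_num)
      have h2 := (hch.hasMFDerivAt.comp s hm')
      have h3 : HasFDerivAt (fun s => extChartAt 𝓘(ℝ, E) (c t) (c s)) _ s :=
        hasMFDerivAt_iff_hasFDerivAt.1 h2
      convert! h3.hasDerivAt using 1
      exact (map_zero (mfderiv 𝓘(ℝ, E) 𝓘(ℝ, E) (extChartAt 𝓘(ℝ, E) (c t)) (c s))).symm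
    filter_upwards [Metric.ball_mem_nhds t hε] with s hs
    have hconst := (convex_ball t ε).is_const_of_fderivWithin_eq_zero
      (f := fun s => extChartAt 𝓘(ℝ, E) (c t) (c s)) (𝕜 := ℝ)
      (fun s hs => (hder s hs).differentiableAt.differentiableWithinAt)
      (fun s hs => by
        rw [fderivWithin_of_isOpen Metric.isOpen_ball hs]
        have := (hder s hs).hasFDerivAt.fderiv
        rw [this]; ext; simp)
      hs (Metric.mem_ball_self hε)
    exact (extChartAt 𝓘(ℝ, E) (c t)).injOn (hball s hs) ht hconst
  exact hloc.apply_eq_of_isPreconnected isPreconnected_univ (mem_univ _) (mem_univ _)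

end Curve

/-! ### The conformal metric `(1 / k + r) g`: Christoffel symbols and conservation of energy. -/

section Conformal

theorem hasDerivAt_comp_path {E F : Type*} [NormedAddCommGroup E] [NormedSpace ℝ E]
    [NormedAddCommGroup F] [NormedSpace ℝ F] {B : E → F} {x : ℝ → E} {t : ℝ} {x' : E}
    (hB : DifferentiableAt ℝ B (x t)) (hx : HasDerivAt x x' t) :
    HasDerivAt (fun s => B (x s)) (fderiv ℝ B (x t) x') t :=
  hB.hasFDerivAt.comp_hasDerivAt t hx

theorem hasDerivAt_bilinear {E : Type*} [NormedAddCommGroup E] [NormedSpace ℝ E]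
    {B : E → E →L[ℝ] E →L[ℝ] ℝ} {x v : ℝ → E} {t : ℝ} {x' v' : E}
    (hB : DifferentiableAt ℝ B (x t)) (hx : HasDerivAt x x' t) (hv : HasDerivAt v v' t) :
    HasDerivAt (fun s => B (x s) (v s) (v s))
      (fderiv ℝ B (x t) x' (v t) (v t) + B (x t) v' (v t) + B (x t) (v t) v') t := by
  have h₁ : HasDerivAt (fun s => B (x s)) (fderiv ℝ B (x t) x') t :=
    @hasDerivAt_comp_path E (E →L[ℝ] E →L[ℝ] ℝ) _ _ inferInstance inferInstance B x t x' hB hx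
  have h := (h₁.clm_apply hv).clm_apply hv
  refine h.congr_deriv ?_
  simp

variable {E : Type*} [NormedAddCommGroup E] [NormedSpace ℝ E]
  {M : Type*} [TopologicalSpace M] [ChartedSpace E M] {k : M → ℝ} {r : ℝ}

theorem IsGeodesicOn.contMDiff {h : Tensor2 𝓘(ℝ, E) M} {c : ℝ → M}
    (hc : IsGeodesicOn 𝓘(ℝ, E) h c univ) : ContMDiff 𝓘(ℝ, ℝ) 𝓘(ℝ, E) ∞ c :=
  contMDiffOn_univ.1 hc.1

theorem IsGeodesicOn.equation {h : Tensor2 𝓘(ℝ, E) M} {c : ℝ → M}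
    (hc : IsGeodesicOn 𝓘(ℝ, E) h c univ) (t : ℝ) (w : E) :
    chartMetric 𝓘(ℝ, E) h (c t) (extChartAt 𝓘(ℝ, E) (c t) (c t))
        (deriv (deriv (fun s => extChartAt 𝓘(ℝ, E) (c t) (c s))) t) w
      + christoffel 𝓘(ℝ, E) h (c t) (extChartAt 𝓘(ℝ, E) (c t) (c t))
        (deriv (fun s => extChartAt 𝓘(ℝ, E) (c t) (c s)) t)
        (deriv (fun s => extChartAt 𝓘(ℝ, E) (c t) (c s)) t) w = 0 := by
  have := hc.2 t (mem_univ t) w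
  simpa only [derivWithin_univ] using this

theorem contMDiff_conformalFactor (hk : ContMDiff 𝓘(ℝ, E) 𝓘(ℝ, ℝ) ∞ k) (hk0 : ∀ x, k x ≠ 0) :
    ContMDiff 𝓘(ℝ, E) 𝓘(ℝ, ℝ) ∞ (fun x => 1 / k x + r) := by
  intro x
  have h : ContDiffAt ℝ ∞ (fun y : ℝ => 1 / y + r) (k x) :=
    (contDiffAt_const.div contDiffAt_id (hk0 x)).add contDiffAt_const
  exact h.contMDiffAt.comp x (hk x)

variable [IsManifold 𝓘(ℝ, E) ∞ M]
  (g : ContMDiffRiemannianMetric 𝓘(ℝ, E) ∞ E (fun x : M => TangentSpace 𝓘(ℝ, E) x))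

theorem chartMetric_metricG (p : M) (z v w : E) :
    chartMetric 𝓘(ℝ, E) (metricG (ofMetric g) k r) p z v w
      = (1 / k ((extChartAt 𝓘(ℝ, E) p).symm z) + r) * chartForm g p z v w := by
  rw [← chartMetric_ofMetric]; rfl

theorem metricG_one : metricG (ofMetric g) (fun _ => 1) 0 = ofMetric g := by
  funext x v w
  simp [metricG]

variable [FiniteDimensional ℝ E]

theorem christoffel_ofMetric_self (p : M) {z : E} (hz : z ∈ (extChartAt 𝓘(ℝ, E) p).target)
    (u w : E) :
    christoffel 𝓘(ℝ, E) (ofMetric g) p z u u w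
      = fderiv ℝ (chartForm g p) z u u w - fderiv ℝ (chartForm g p) z w u u / 2 := by
  simp only [christoffel, chartMetricDeriv_ofMetric g p hz]
  ring

theorem differentiableAt_chartMetric_ofMetric (p : M) {z : E}
    (hz : z ∈ (extChartAt 𝓘(ℝ, E) p).target) (v w : E) :
    DifferentiableAt ℝ (fun y => chartMetric 𝓘(ℝ, E) (ofMetric g) p y v w) z := by
  simp only [chartMetric_ofMetric]
  exact ((differentiableAt_chartForm g p hz).clm_apply (differentiableAt_const v)).clm_apply
    (differentiableAt_const w)

theorem differentiableAt_chartMetric_metricG (hk : ContMDiff 𝓘(ℝ, E) 𝓘(ℝ, ℝ) ∞ k)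
    (hk0 : ∀ x, k x ≠ 0) (p : M) {z : E}
    (hz : z ∈ (extChartAt 𝓘(ℝ, E) p).target) (v w : E) :
    DifferentiableAt ℝ (fun y => chartMetric 𝓘(ℝ, E) (metricG (ofMetric g) k r) p y v w) z :=
  (differentiableAt_comp_chart_symm (contMDiff_conformalFactor hk hk0) p hz).mul
    (differentiableAt_chartMetric_ofMetric g p hz v w)

theorem chartMetricDeriv_metricG (hk : ContMDiff 𝓘(ℝ, E) 𝓘(ℝ, ℝ) ∞ k) (hk0 : ∀ x, k x ≠ 0)
    (p : M) {z : E} (hz : z ∈ (extChartAt 𝓘(ℝ, E) p).target) (u v w : E) :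
    chartMetricDeriv 𝓘(ℝ, E) (metricG (ofMetric g) k r) p z u v w
      = fderiv ℝ (fun y => 1 / k ((extChartAt 𝓘(ℝ, E) p).symm y) + r) z u * chartForm g p z v w
        + (1 / k ((extChartAt 𝓘(ℝ, E) p).symm z) + r) * fderiv ℝ (chartForm g p) z u v w := by
  have h1 := (differentiableAt_comp_chart_symm
    (contMDiff_conformalFactor (r := r) hk hk0) p hz).hasFDerivAt
  have h2 := (differentiableAt_chartMetric_ofMetric g p hz v w).hasFDerivAt
  have h3 := (h1.mul h2).fderiv
  have h4 := chartMetricDeriv_ofMetric g p hz u v w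
  unfold chartMetricDeriv at h4 ⊢
  have h5 : (fun y => chartMetric 𝓘(ℝ, E) (metricG (ofMetric g) k r) p y v w)
      = (fun y => 1 / k ((extChartAt 𝓘(ℝ, E) p).symm y) + r)
        * fun y => chartMetric 𝓘(ℝ, E) (ofMetric g) p y v w := rfl
  rw [h5, h3]
  simp only [add_apply, smul_apply, smul_eq_mul]
  rw [h4, chartMetric_ofMetric]
  ring

theorem christoffel_metricG_self (hk : ContMDiff 𝓘(ℝ, E) 𝓘(ℝ, ℝ) ∞ k) (hk0 : ∀ x, k x ≠ 0)
    (p : M) {z : E} (hz : z ∈ (extChartAt 𝓘(ℝ, E) p).target) (u w : E) :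
    christoffel 𝓘(ℝ, E) (metricG (ofMetric g) k r) p z u u w
      = (1 / k ((extChartAt 𝓘(ℝ, E) p).symm z) + r)
          * christoffel 𝓘(ℝ, E) (ofMetric g) p z u u w
        + fderiv ℝ (fun y => 1 / k ((extChartAt 𝓘(ℝ, E) p).symm y) + r) z u * chartForm g p z u w
        - fderiv ℝ (fun y => 1 / k ((extChartAt 𝓘(ℝ, E) p).symm y) + r) z w * chartForm g p z u u
          / 2 := by
  rw [christoffel_ofMetric_self g p hz]
  simp only [christoffel, chartMetricDeriv_metricG g hk hk0 p hz]
  ring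

/-- Testing the geodesic equation against the velocity itself gives half the derivative of the
energy. -/
theorem hasDerivAt_energy (hk : ContMDiff 𝓘(ℝ, E) 𝓘(ℝ, ℝ) ∞ k) (hk0 : ∀ x, k x ≠ 0) {c : ℝ → M}
    (hc : IsGeodesicOn 𝓘(ℝ, E) (metricG (ofMetric g) k r) c univ) (t : ℝ) :
    HasDerivAt (fun s => (1 / k (c s) + r) * speedSq g c s) 0 t := by
  have hcs := hc.contMDiff
  have hs := mem_extChartAt_source (I := 𝓘(ℝ, E)) (c t)
  have hz := (extChartAt 𝓘(ℝ, E) (c t)).map_source hs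
  have heq := hc.equation t (deriv (fun s => extChartAt 𝓘(ℝ, E) (c t) (c s)) t)
  rw [christoffel_metricG_self g hk hk0 _ hz, christoffel_ofMetric_self g _ hz,
    chartMetric_metricG, (extChartAt 𝓘(ℝ, E) (c t)).left_inv hs] at heq
  have hx2 : ContDiffAt ℝ 2 (fun s => extChartAt 𝓘(ℝ, E) (c t) (c s)) t :=
    (contDiffAt_chart_curve hcs _ hs).of_le (by norm_cast)
  have hx := (hx2.differentiableAt (by norm_num)).hasDerivAt
  have hx' := (differentiableAt_deriv_of_contDiffAt hx2).hasDerivAt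
  have hBB := hasDerivAt_bilinear (differentiableAt_chartForm g (c t) hz) hx hx'
  have hκ := hasDerivAt_comp_curve (contMDiff_conformalFactor (r := r) hk hk0) hcs (c t) hs
  have hprod := hκ.mul hBB
  have hev := hprod.congr_of_eventuallyEq (f₁ := fun s => (1 / k (c s) + r) * speedSq g c s) (by
    filter_upwards [eventually_mem_source hcs (c t) hs] with s hs'
    rw [speedSq_eq_chartForm g hcs (c t) hs']
    rfl)
  refine hev.congr_deriv ?_
  rw [chartForm_symm g (c t) _ (deriv (fun s => extChartAt 𝓘(ℝ, E) (c t) (c s)) t)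
    (deriv (deriv (fun s => extChartAt 𝓘(ℝ, E) (c t) (c s))) t)]
  linear_combination 2 * heq

theorem energy_eq (hk : ContMDiff 𝓘(ℝ, E) 𝓘(ℝ, ℝ) ∞ k) (hk0 : ∀ x, k x ≠ 0) {c : ℝ → M}
    (hc : IsGeodesicOn 𝓘(ℝ, E) (metricG (ofMetric g) k r) c univ) (s t : ℝ) :
    (1 / k (c s) + r) * speedSq g c s = (1 / k (c t) + r) * speedSq g c t :=
  is_const_of_deriv_eq_zero (fun t => (hasDerivAt_energy g hk hk0 hc t).differentiableAt)
    (fun t => (hasDerivAt_energy g hk hk0 hc t).deriv) s t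

/-- With `k = 1` and `r = 0` the conformal factor is `1`, so energy conservation becomes
conservation of speed. -/
theorem speedSq_eq {c : ℝ → M} (hc : IsGeodesicOn 𝓘(ℝ, E) (ofMetric g) c univ) (s t : ℝ) :
    speedSq g c s = speedSq g c t := by
  have := energy_eq g (k := fun _ => 1) (r := 0) contMDiff_const (fun _ => one_ne_zero)
    (by rwa [metricG_one]) s t (c := c)
  simpa using this

end Conformal

/-! ### The geodesic equation of a warped sum. -/

section Warped

variable {E₁ : Type*} [NormedAddCommGroup E₁] [NormedSpace ℝ E₁]
  {M₁ : Type*} [TopologicalSpace M₁] [ChartedSpace E₁ M₁] [IsManifold 𝓘(ℝ, E₁) ∞ M₁]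
  {E₂ : Type*} [NormedAddCommGroup E₂] [NormedSpace ℝ E₂]
  {M₂ : Type*} [TopologicalSpace M₂] [ChartedSpace E₂ M₂] [IsManifold 𝓘(ℝ, E₂) ∞ M₂]

theorem chartMetricDeriv_warpedSum (h₁ : Tensor2 𝓘(ℝ, E₁) M₁) (f : M₁ → ℝ)
    (h₂ : Tensor2 𝓘(ℝ, E₂) M₂) (p : M₁ × M₂) {z : E₁ × E₂}
    (hz₁ : z.1 ∈ (extChartAt 𝓘(ℝ, E₁) p.1).target) (hz₂ : z.2 ∈ (extChartAt 𝓘(ℝ, E₂) p.2).target)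
    (d₁ : ∀ v w, DifferentiableAt ℝ (fun y => chartMetric 𝓘(ℝ, E₁) h₁ p.1 y v w) z.1)
    (d₂ : ∀ v w, DifferentiableAt ℝ (fun y => chartMetric 𝓘(ℝ, E₂) h₂ p.2 y v w) z.2)
    (df : DifferentiableAt ℝ (fun y => f ((extChartAt 𝓘(ℝ, E₁) p.1).symm y)) z.1)
    (u v w : E₁ × E₂) :
    chartMetricDeriv (𝓘(ℝ, E₁).prod 𝓘(ℝ, E₂)) (warpedSum h₁ f h₂) p z u v w
      = chartMetricDeriv 𝓘(ℝ, E₁) h₁ p.1 z.1 u.1 v.1 w.1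
        + fderiv ℝ (fun y => f ((extChartAt 𝓘(ℝ, E₁) p.1).symm y)) z.1 u.1
          * chartMetric 𝓘(ℝ, E₂) h₂ p.2 z.2 v.2 w.2
        + f ((extChartAt 𝓘(ℝ, E₁) p.1).symm z.1)
          * chartMetricDeriv 𝓘(ℝ, E₂) h₂ p.2 z.2 u.2 v.2 w.2 := by
  have hfst : HasFDerivAt (fun y : E₁ × E₂ => y.1) (ContinuousLinearMap.fst ℝ E₁ E₂) z :=
    hasFDerivAt_fst
  have hsnd : HasFDerivAt (fun y : E₁ × E₂ => y.2) (ContinuousLinearMap.snd ℝ E₁ E₂) z :=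
    hasFDerivAt_snd
  have H₁ := (d₁ v.1 w.1).hasFDerivAt.comp z hfst
  have H₂ := (d₂ v.2 w.2).hasFDerivAt.comp z hsnd
  have Hf := df.hasFDerivAt.comp z hfst
  have H := H₁.add (Hf.mul H₂)
  have hH := H.congr_of_eventuallyEq (f₁ := fun y : E₁ × E₂ =>
      chartMetric (𝓘(ℝ, E₁).prod 𝓘(ℝ, E₂)) (warpedSum h₁ f h₂) p y v w) (by
    have hn₁ := continuousAt_fst.eventually ((isOpen_extChartAt_target p.1).mem_nhds hz₁)
    have hn₂ := continuousAt_snd.eventually ((isOpen_extChartAt_target p.2).mem_nhds hz₂)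
    filter_upwards [hn₁, hn₂] with y hy₁ hy₂
    exact chartMetric_warpedSum h₁ f h₂ p hy₁ hy₂ v w)
  unfold chartMetricDeriv
  rw [hH.fderiv]
  simp only [Function.comp, add_apply, smul_apply, smul_eq_mul, ContinuousLinearMap.comp_apply,
    ContinuousLinearMap.coe_fst', ContinuousLinearMap.coe_snd']
  ring

theorem christoffel_warpedSum_self (h₁ : Tensor2 𝓘(ℝ, E₁) M₁) (f : M₁ → ℝ)
    (h₂ : Tensor2 𝓘(ℝ, E₂) M₂) (p : M₁ × M₂) {z : E₁ × E₂}
    (hz₁ : z.1 ∈ (extChartAt 𝓘(ℝ, E₁) p.1).target) (hz₂ : z.2 ∈ (extChartAt 𝓘(ℝ, E₂) p.2).target)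
    (d₁ : ∀ v w, DifferentiableAt ℝ (fun y => chartMetric 𝓘(ℝ, E₁) h₁ p.1 y v w) z.1)
    (d₂ : ∀ v w, DifferentiableAt ℝ (fun y => chartMetric 𝓘(ℝ, E₂) h₂ p.2 y v w) z.2)
    (df : DifferentiableAt ℝ (fun y => f ((extChartAt 𝓘(ℝ, E₁) p.1).symm y)) z.1)
    (u w : E₁ × E₂) :
    christoffel (𝓘(ℝ, E₁).prod 𝓘(ℝ, E₂)) (warpedSum h₁ f h₂) p z u u w
      = christoffel 𝓘(ℝ, E₁) h₁ p.1 z.1 u.1 u.1 w.1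
        + f ((extChartAt 𝓘(ℝ, E₁) p.1).symm z.1)
          * christoffel 𝓘(ℝ, E₂) h₂ p.2 z.2 u.2 u.2 w.2
        + fderiv ℝ (fun y => f ((extChartAt 𝓘(ℝ, E₁) p.1).symm y)) z.1 u.1
          * chartMetric 𝓘(ℝ, E₂) h₂ p.2 z.2 u.2 w.2
        - fderiv ℝ (fun y => f ((extChartAt 𝓘(ℝ, E₁) p.1).symm y)) z.1 w.1
          * chartMetric 𝓘(ℝ, E₂) h₂ p.2 z.2 u.2 u.2 / 2 := by
  simp only [christoffel, chartMetricDeriv_warpedSum h₁ f h₂ p hz₁ hz₂ d₁ d₂ df]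
  ring

/-- The equation with lowered index is linear in the test vector `(w₁, w₂)`, so it is the sum of a
horizontal equation, with a force term from the derivative of `f`, and a vertical one. -/
theorem isGeodesicOn_warpedSum {h₁ : Tensor2 𝓘(ℝ, E₁) M₁} {f : M₁ → ℝ}
    {h₂ : Tensor2 𝓘(ℝ, E₂) M₂} {S : Set ℝ} (hS : UniqueDiffOn ℝ S)
    (hf : ContMDiff 𝓘(ℝ, E₁) 𝓘(ℝ, ℝ) ∞ f)
    (d₁ : ∀ p : M₁, ∀ v w, DifferentiableAt ℝ (fun y => chartMetric 𝓘(ℝ, E₁) h₁ p y v w)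
      (extChartAt 𝓘(ℝ, E₁) p p))
    (d₂ : ∀ p : M₂, ∀ v w, DifferentiableAt ℝ (fun y => chartMetric 𝓘(ℝ, E₂) h₂ p y v w)
      (extChartAt 𝓘(ℝ, E₂) p p))
    {γ : ℝ → M₁} {τ : ℝ → M₂} (hγ : ContMDiff 𝓘(ℝ, ℝ) 𝓘(ℝ, E₁) ∞ γ)
    (hτ : ContMDiff 𝓘(ℝ, ℝ) 𝓘(ℝ, E₂) ∞ τ)
    (eq : ∀ t ∈ S, ∀ w₁ w₂,
      let x₁ : ℝ → E₁ := fun s => extChartAt 𝓘(ℝ, E₁) (γ t) (γ s)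
      let x₂ : ℝ → E₂ := fun s => extChartAt 𝓘(ℝ, E₂) (τ t) (τ s)
      let F : E₁ →L[ℝ] ℝ := fderiv ℝ (fun y => f ((extChartAt 𝓘(ℝ, E₁) (γ t)).symm y)) (x₁ t)
      chartMetric 𝓘(ℝ, E₁) h₁ (γ t) (x₁ t) (deriv (deriv x₁) t) w₁
        + christoffel 𝓘(ℝ, E₁) h₁ (γ t) (x₁ t) (deriv x₁ t) (deriv x₁ t) w₁
        - F w₁ * chartMetric 𝓘(ℝ, E₂) h₂ (τ t) (x₂ t) (deriv x₂ t) (deriv x₂ t) / 2 = 0 ∧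
      f (γ t) * (chartMetric 𝓘(ℝ, E₂) h₂ (τ t) (x₂ t) (deriv (deriv x₂) t) w₂
        + christoffel 𝓘(ℝ, E₂) h₂ (τ t) (x₂ t) (deriv x₂ t) (deriv x₂ t) w₂)
        + F (deriv x₁ t) * chartMetric 𝓘(ℝ, E₂) h₂ (τ t) (x₂ t) (deriv x₂ t) w₂ = 0) :
    IsGeodesicOn (𝓘(ℝ, E₁).prod 𝓘(ℝ, E₂)) (warpedSum h₁ f h₂) (fun s => (γ s, τ s)) S := by
  refine ⟨(hγ.prodMk hτ).contMDiffOn, ?_⟩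
  intro t ht w x
  have hs₁ := mem_extChartAt_source (I := 𝓘(ℝ, E₁)) (γ t)
  have hs₂ := mem_extChartAt_source (I := 𝓘(ℝ, E₂)) (τ t)
  have hz₁ := (extChartAt 𝓘(ℝ, E₁) (γ t)).map_source hs₁
  have hz₂ := (extChartAt 𝓘(ℝ, E₂) (τ t)).map_source hs₂
  obtain ⟨e₁, e₂⟩ := eq t ht w.1 w.2
  have hc₁ : ContDiffAt ℝ 2 (fun s => extChartAt 𝓘(ℝ, E₁) (γ t) (γ s)) t :=
    (contDiffAt_chart_curve hγ _ hs₁).of_le (by norm_cast)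
  have hc₂ : ContDiffAt ℝ 2 (fun s => extChartAt 𝓘(ℝ, E₂) (τ t) (τ s)) t :=
    (contDiffAt_chart_curve hτ _ hs₂).of_le (by norm_cast)
  have hx : x = fun s => (extChartAt 𝓘(ℝ, E₁) (γ t) (γ s), extChartAt 𝓘(ℝ, E₂) (τ t) (τ s)) := by
    funext s; exact extChartAt_prod_apply _ _
  have hxc : ContDiffAt ℝ 2 x t := hx ▸ hc₁.prodMk hc₂
  have hd : deriv x =ᶠ[𝓝 t] fun s => (deriv (fun s => extChartAt 𝓘(ℝ, E₁) (γ t) (γ s)) s,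
      deriv (fun s => extChartAt 𝓘(ℝ, E₂) (τ t) (τ s)) s) := by
    filter_upwards [eventually_differentiableAt_of_contDiffAt hc₁,
      eventually_differentiableAt_of_contDiffAt hc₂] with s h₁ h₂
    rw [hx]
    exact (h₁.hasDerivAt.prodMk h₂.hasDerivAt).deriv
  have hdd : deriv (deriv x) t = (deriv (deriv (fun s => extChartAt 𝓘(ℝ, E₁) (γ t) (γ s))) t,
      deriv (deriv (fun s => extChartAt 𝓘(ℝ, E₂) (τ t) (τ s))) t) := by
    rw [hd.deriv_eq]
    exact ((differentiableAt_deriv_of_contDiffAt hc₁).hasDerivAt.prodMk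
      (differentiableAt_deriv_of_contDiffAt hc₂).hasDerivAt).deriv
  have hxt : x t = (extChartAt 𝓘(ℝ, E₁) (γ t) (γ t), extChartAt 𝓘(ℝ, E₂) (τ t) (τ t)) := by
    rw [hx]
  rw [derivWithin_derivWithin_eq hS ht hxc,
    (hxc.differentiableAt (by norm_num)).derivWithin (hS t ht), hdd, hd.self_of_nhds, hxt,
    chartMetric_warpedSum h₁ f h₂ (γ t, τ t) hz₁ hz₂,
    christoffel_warpedSum_self h₁ f h₂ (γ t, τ t) hz₁ hz₂ (d₁ _) (d₂ _)
      (differentiableAt_comp_chart_symm hf (γ t) hz₁)]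
  simp only [(extChartAt 𝓘(ℝ, E₁) (γ t)).left_inv hs₁]
  linear_combination e₁ + e₂

end Warped

/-! ### Acceleration of reparametrized geodesics. -/

section Reparam

variable {E : Type*} [NormedAddCommGroup E] [NormedSpace ℝ E]
  {M : Type*} [TopologicalSpace M] [ChartedSpace E M] [IsManifold 𝓘(ℝ, E) ∞ M]
  (g : ContMDiffRiemannianMetric 𝓘(ℝ, E) ∞ E (fun x : M => TangentSpace 𝓘(ℝ, E) x))

theorem deriv_chart_reparam {c : ℝ → M} (hc : ContMDiff 𝓘(ℝ, ℝ) 𝓘(ℝ, E) ∞ c) {Φ : ℝ → ℝ}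
    (hΦ : ContDiff ℝ ∞ Φ) (s : ℝ) :
    let y : ℝ → E := fun σ => extChartAt 𝓘(ℝ, E) (c (Φ s)) (c σ)
    deriv (fun σ => extChartAt 𝓘(ℝ, E) (c (Φ s)) (c (Φ σ))) s = deriv Φ s • deriv y (Φ s) ∧
    deriv (deriv (fun σ => extChartAt 𝓘(ℝ, E) (c (Φ s)) (c (Φ σ)))) s
      = deriv (deriv Φ) s • deriv y (Φ s) + (deriv Φ s) ^ 2 • deriv (deriv y) (Φ s) :=
  deriv_comp_reparam (y := fun σ => extChartAt 𝓘(ℝ, E) (c (Φ s)) (c σ))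
    ((contDiffAt_chart_curve hc _ (mem_extChartAt_source (c (Φ s)))).of_le (by norm_cast))
    (hΦ.of_le (by norm_cast))

theorem chartMetricDeriv_smul_first (p : M) (z : E) (a : ℝ) (u v w : E) :
    chartMetricDeriv 𝓘(ℝ, E) (ofMetric g) p z (a • u) v w
      = a * chartMetricDeriv 𝓘(ℝ, E) (ofMetric g) p z u v w := by
  simp [chartMetricDeriv]

variable [FiniteDimensional ℝ E]

theorem chartMetricDeriv_smul_second (p : M) {z : E} (hz : z ∈ (extChartAt 𝓘(ℝ, E) p).target)
    (a : ℝ) (u v w : E) :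
    chartMetricDeriv 𝓘(ℝ, E) (ofMetric g) p z u (a • v) w
      = a * chartMetricDeriv 𝓘(ℝ, E) (ofMetric g) p z u v w := by
  have h : (fun y => chartMetric 𝓘(ℝ, E) (ofMetric g) p y (a • v) w)
      = fun y => a * chartMetric 𝓘(ℝ, E) (ofMetric g) p y v w := by
    funext y
    simp [chartMetric_ofMetric]
  unfold chartMetricDeriv
  rw [h, fderiv_const_mul (differentiableAt_chartMetric_ofMetric g p hz v w)]
  rfl

theorem chartMetricDeriv_smul_third (p : M) {z : E} (hz : z ∈ (extChartAt 𝓘(ℝ, E) p).target)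
    (a : ℝ) (u v w : E) :
    chartMetricDeriv 𝓘(ℝ, E) (ofMetric g) p z u v (a • w)
      = a * chartMetricDeriv 𝓘(ℝ, E) (ofMetric g) p z u v w := by
  have h : (fun y => chartMetric 𝓘(ℝ, E) (ofMetric g) p y v (a • w))
      = fun y => a * chartMetric 𝓘(ℝ, E) (ofMetric g) p y v w := by
    funext y
    simp [chartMetric_ofMetric]
  unfold chartMetricDeriv
  rw [h, fderiv_const_mul (differentiableAt_chartMetric_ofMetric g p hz v w)]
  rfl

theorem christoffel_smul (p : M) {z : E} (hz : z ∈ (extChartAt 𝓘(ℝ, E) p).target)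
    (a : ℝ) (u w : E) :
    christoffel 𝓘(ℝ, E) (ofMetric g) p z (a • u) (a • u) w
      = a ^ 2 * christoffel 𝓘(ℝ, E) (ofMetric g) p z u u w := by
  simp only [christoffel, chartMetricDeriv_smul_first, chartMetricDeriv_smul_second g p hz,
    chartMetricDeriv_smul_third g p hz]
  ring

/-- The covariant acceleration of a reparametrized geodesic of a Riemannian metric. -/
theorem acceleration_reparam {c : ℝ → M} (hc : IsGeodesicOn 𝓘(ℝ, E) (ofMetric g) c univ)
    {Φ : ℝ → ℝ} (hΦ : ContDiff ℝ ∞ Φ) (s : ℝ) (w : E) :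
    let x : ℝ → E := fun σ => extChartAt 𝓘(ℝ, E) (c (Φ s)) (c (Φ σ))
    let y : ℝ → E := fun σ => extChartAt 𝓘(ℝ, E) (c (Φ s)) (c σ)
    chartMetric 𝓘(ℝ, E) (ofMetric g) (c (Φ s)) (x s) (deriv (deriv x) s) w
      + christoffel 𝓘(ℝ, E) (ofMetric g) (c (Φ s)) (x s) (deriv x s) (deriv x s) w
      = deriv (deriv Φ) s * chartForm g (c (Φ s)) (x s) (deriv y (Φ s)) w := by
  intro x y
  have hz := mem_extChartAt_target (I := 𝓘(ℝ, E)) (c (Φ s))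
  have heq := hc.equation (Φ s) w
  obtain ⟨e₁, e₂⟩ := deriv_chart_reparam hc.contMDiff hΦ s
  simp only [x, y]
  rw [e₁, e₂]
  rw [chartMetric_ofMetric] at heq ⊢
  rw [christoffel_smul g _ hz]
  simp only [map_smul, map_add, add_apply, smul_apply, smul_eq_mul]
  linear_combination deriv Φ s ^ 2 * heq

/-- The acceleration with respect to `g` of a curve `c ∘ Φ`, where `c` is a geodesic of the
conformal metric `(1 / k + r) g`, and `Φ' = A (1 / k + r) ∘ c ∘ Φ`. -/
theorem acceleration_conformal_reparam {k : M → ℝ} {r : ℝ} (hk : ContMDiff 𝓘(ℝ, E) 𝓘(ℝ, ℝ) ∞ k)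
    (hk0 : ∀ x, k x ≠ 0) {c : ℝ → M}
    (hc : IsGeodesicOn 𝓘(ℝ, E) (metricG (ofMetric g) k r) c univ)
    {Φ : ℝ → ℝ} (hΦ : ContDiff ℝ ∞ Φ) {A : ℝ}
    (hΦ' : ∀ s, deriv Φ s = A * (1 / k (c (Φ s)) + r)) (s : ℝ) (w : E) :
    let x : ℝ → E := fun σ => extChartAt 𝓘(ℝ, E) (c (Φ s)) (c (Φ σ))
    chartMetric 𝓘(ℝ, E) (ofMetric g) (c (Φ s)) (x s) (deriv (deriv x) s) w
      + christoffel 𝓘(ℝ, E) (ofMetric g) (c (Φ s)) (x s) (deriv x s) (deriv x s) w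
      = A ^ 2 * ((1 / k (c (Φ s)) + r) * speedSq g c (Φ s))
        * fderiv ℝ (fun y => 1 / k ((extChartAt 𝓘(ℝ, E) (c (Φ s))).symm y) + r) (x s) w / 2 := by
  intro x
  have hz := mem_extChartAt_target (I := 𝓘(ℝ, E)) (c (Φ s))
  have hs := mem_extChartAt_source (I := 𝓘(ℝ, E)) (c (Φ s))
  have heq := hc.equation (Φ s) w
  obtain ⟨e₁, e₂⟩ := deriv_chart_reparam hc.contMDiff hΦ s
  have hκ := hasDerivAt_comp_curve (contMDiff_conformalFactor (r := r) hk hk0) hc.contMDiff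
    (c (Φ s)) hs
  have hΦd : HasDerivAt Φ (deriv Φ s) s := (hΦ.differentiable (by norm_num) s).hasDerivAt
  have hΦ'' := (HasDerivAt.congr_of_eventuallyEq (f₁ := deriv Φ) ((hκ.comp s hΦd).const_mul A)
    (.of_eq (funext hΦ'))).deriv
  simp only [x]
  rw [e₁, e₂, speedSq_eq_chartForm g hc.contMDiff _ hs]
  rw [christoffel_metricG_self g hk hk0 _ hz, chartMetric_metricG,
    (extChartAt 𝓘(ℝ, E) (c (Φ s))).left_inv hs] at heq
  rw [christoffel_smul g _ hz, chartMetric_ofMetric]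
  simp only [map_smul, map_add, add_apply, smul_apply, smul_eq_mul]
  rw [hΦ'', hΦ' s]
  -- `Φ'' = A² f df(ẏ)`, with `f = 1 / k + r` and `ẏ` the velocity of `c`, matches the tangential
  -- term of the conformal Christoffel symbol. Only the gradient term survives.
  linear_combination A ^ 2 * (1 / k (c (Φ s)) + r) * heq

end Reparam

/-! ### Geodesics of the two product metrics. -/

section Product

variable {E₁ : Type*} [NormedAddCommGroup E₁] [NormedSpace ℝ E₁] [FiniteDimensional ℝ E₁]
  {M₁ : Type*} [TopologicalSpace M₁] [ChartedSpace E₁ M₁] [IsManifold 𝓘(ℝ, E₁) ∞ M₁]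
  {E₂ : Type*} [NormedAddCommGroup E₂] [NormedSpace ℝ E₂] [FiniteDimensional ℝ E₂]
  {M₂ : Type*} [TopologicalSpace M₂] [ChartedSpace E₂ M₂] [IsManifold 𝓘(ℝ, E₂) ∞ M₂]
  (g₁ : ContMDiffRiemannianMetric 𝓘(ℝ, E₁) ∞ E₁ (fun x : M₁ => TangentSpace 𝓘(ℝ, E₁) x))
  (g₂ : ContMDiffRiemannianMetric 𝓘(ℝ, E₂) ∞ E₂ (fun y : M₂ => TangentSpace 𝓘(ℝ, E₂) y))
  {k : M₁ → ℝ} {r : ℝ} {μ : ℝ → M₁} {ν : ℝ → M₂}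

/-- Reparametrizing the components of a geodesic of `G_r + g₂` gives a geodesic of `g₁ - k g₂`. -/
theorem isGeodesicOn_metricWarped (hk : ContMDiff 𝓘(ℝ, E₁) 𝓘(ℝ, ℝ) ∞ k) (hk0 : ∀ x, k x ≠ 0)
    (hμ : IsGeodesicOn 𝓘(ℝ, E₁) (metricG (ofMetric g₁) k r) μ univ)
    (hν : IsGeodesicOn 𝓘(ℝ, E₂) (ofMetric g₂) ν univ)
    {Φ Ψ : ℝ → ℝ} (hΦ : ContDiff ℝ ∞ Φ) (hΨ : ContDiff ℝ ∞ Ψ) {A B : ℝ}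
    (hΦ' : ∀ s, deriv Φ s = A * (1 / k (μ (Φ s)) + r))
    (hΨ' : ∀ s, deriv Ψ s = B / k (μ (Φ s)))
    (henergy : A ^ 2 * ((1 / k (μ 0) + r) * speedSq g₁ μ 0) = B ^ 2 * speedSq g₂ ν 0)
    {S : Set ℝ} (hS : UniqueDiffOn ℝ S) :
    IsGeodesicOn (𝓘(ℝ, E₁).prod 𝓘(ℝ, E₂)) (metricWarped (ofMetric g₁) k (ofMetric g₂))
      (fun s => (μ (Φ s), ν (Ψ s))) S := by
  have hγ : ContMDiff 𝓘(ℝ, ℝ) 𝓘(ℝ, E₁) ∞ (fun s => μ (Φ s)) := hμ.contMDiff.comp hΦ.contMDiff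
  have hτ : ContMDiff 𝓘(ℝ, ℝ) 𝓘(ℝ, E₂) ∞ (fun s => ν (Ψ s)) := hν.contMDiff.comp hΨ.contMDiff
  refine isGeodesicOn_warpedSum hS hk.neg
    (fun p => differentiableAt_chartMetric_ofMetric g₁ p (mem_extChartAt_target p))
    (fun p => differentiableAt_chartMetric_ofMetric g₂ p (mem_extChartAt_target p)) hγ hτ ?_
  intro s _ w₁ w₂ x₁ x₂ F
  have hs₁ := mem_extChartAt_source (I := 𝓘(ℝ, E₁)) (μ (Φ s))
  have hz₁ := mem_extChartAt_target (I := 𝓘(ℝ, E₁)) (μ (Φ s))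
  have hs₂ := mem_extChartAt_source (I := 𝓘(ℝ, E₂)) (ν (Ψ s))
  have hkd := differentiableAt_comp_chart_symm hk (μ (Φ s)) hz₁
  have hkz : k ((extChartAt 𝓘(ℝ, E₁) (μ (Φ s))).symm (extChartAt 𝓘(ℝ, E₁) (μ (Φ s)) (μ (Φ s))))
      = k (μ (Φ s)) := by rw [(extChartAt 𝓘(ℝ, E₁) (μ (Φ s))).left_inv hs₁]
  have hF : ∀ w, F w
      = -fderiv ℝ (fun y => k ((extChartAt 𝓘(ℝ, E₁) (μ (Φ s))).symm y)) (x₁ s) w := by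
    intro w
    simp only [F, fderiv_fun_neg, neg_apply]
  have hsp := speedSq_comp g₂ hν.contMDiff hΨ s
  rw [speedSq_eq_chartForm g₂ hτ _ hs₂, hΨ' s, speedSq_eq g₂ hν _ 0] at hsp
  have hne := hk0 (μ (Φ s))
  constructor
  · have hacc := acceleration_conformal_reparam g₁ hk hk0 hμ hΦ hΦ' s w₁
    dsimp only at hacc
    -- Conservation moves the energy of `μ` to parameter `0`, where `henergy` trades it for the
    -- speed of `ν`; the differential of `1 / k + r` supplies the factor `-1 / k²`.
    rw [fderiv_one_div_add hkd (by rw [hkz]; exact hne), hkz,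
      energy_eq g₁ hk hk0 hμ _ 0, henergy] at hacc
    refine (congrArg₂ (fun a b => a - F w₁ * b / 2) hacc hsp).trans ?_
    simp only [hF, x₁]
    field_simp
    ring
  · have hacc := acceleration_reparam g₂ hν hΨ s w₂
    refine (congrArg (fun a => -k (μ (Φ s)) * a + F (deriv x₁ s) *
      chartMetric 𝓘(ℝ, E₂) (ofMetric g₂) (ν (Ψ s)) (x₂ s) (deriv x₂ s) w₂) hacc).trans ?_
    have hkd' := hasDerivAt_comp_curve hk hγ (μ (Φ s)) hs₁
    have hΨ'' : deriv (deriv Ψ) s = B * (-fderiv ℝ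
        (fun y => k ((extChartAt 𝓘(ℝ, E₁) (μ (Φ s))).symm y)) (x₁ s) (deriv x₁ s)
          / k (μ (Φ s)) ^ 2) := by
      rw [funext hΨ']
      simp only [div_eq_mul_inv B]
      exact ((hkd'.inv hne).const_mul B).deriv
    have e₁ := (deriv_chart_reparam hν.contMDiff hΨ s).1
    simp only [hF, x₂, chartMetric_ofMetric]
    rw [e₁, hΨ'', hΨ' s]
    simp only [map_smul, smul_apply, smul_eq_mul]
    field_simp
    ring

theorem isGeodesicOn_metricSum (hk : ContMDiff 𝓘(ℝ, E₁) 𝓘(ℝ, ℝ) ∞ k) (hk0 : ∀ x, k x ≠ 0)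
    (hμ : IsGeodesicOn 𝓘(ℝ, E₁) (metricG (ofMetric g₁) k r) μ univ)
    (hν : IsGeodesicOn 𝓘(ℝ, E₂) (ofMetric g₂) ν univ) (t β : ℝ)
    {S : Set ℝ} (hS : UniqueDiffOn ℝ S) :
    IsGeodesicOn (𝓘(ℝ, E₁).prod 𝓘(ℝ, E₂)) (metricSum (ofMetric g₁) k r (ofMetric g₂))
      (fun s => (μ (t * s), ν (β * s))) S := by
  have hlin : ∀ a : ℝ, ContDiff ℝ ∞ (fun s : ℝ => a * s) := fun a => contDiff_const.mul contDiff_id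
  have hd : ∀ a : ℝ, deriv (fun s : ℝ => a * s) = fun _ => a := fun a => by
    funext s; simp
  have hγ : ContMDiff 𝓘(ℝ, ℝ) 𝓘(ℝ, E₁) ∞ (fun s => μ (t * s)) :=
    hμ.contMDiff.comp (hlin t).contMDiff
  have hτ : ContMDiff 𝓘(ℝ, ℝ) 𝓘(ℝ, E₂) ∞ (fun s => ν (β * s)) :=
    hν.contMDiff.comp (hlin β).contMDiff
  refine isGeodesicOn_warpedSum hS contMDiff_const
    (fun p => differentiableAt_chartMetric_metricG g₁ hk hk0 p (mem_extChartAt_target p))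
    (fun p => differentiableAt_chartMetric_ofMetric g₂ p (mem_extChartAt_target p)) hγ hτ ?_
  intro s _ w₁ w₂ x₁ x₂ F
  -- The warping function is constant, so the two equations decouple.
  have hF : F = 0 := by simp [F]
  have hz₁ := mem_extChartAt_target (I := 𝓘(ℝ, E₁)) (μ (t * s))
  rw [hF]
  constructor
  · have heq := hμ.equation (t * s) w₁
    obtain ⟨e₁, e₂⟩ := deriv_chart_reparam hμ.contMDiff (hlin t) s
    simp only [x₁]
    rw [e₁, e₂, hd]
    rw [christoffel_metricG_self g₁ hk hk0 _ hz₁, chartMetric_metricG] at heq ⊢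
    rw [christoffel_smul g₁ _ hz₁]
    simp only [map_smul, map_add, add_apply, smul_apply, smul_eq_mul, zero_apply, deriv_const]
    linear_combination t ^ 2 * heq
  · have hacc := acceleration_reparam g₂ hν (hlin β) s w₂
    refine (congrArg (fun a => (1 : ℝ) * a + (0 : E₁ →L[ℝ] ℝ) (deriv x₁ s) *
      chartMetric 𝓘(ℝ, E₂) (ofMetric g₂) (ν (β * s)) (x₂ s) (deriv x₂ s) w₂) hacc).trans ?_
    rw [hd]
    simp

end Product

/-! ### Reparametrizations of the unit interval. -/

section Reparametrization

theorem hasDerivAt_integral {p : ℝ → ℝ} (hp : Continuous p) (s : ℝ) :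
    HasDerivAt (fun s => ∫ v in (0 : ℝ)..s, p v) (p s) s :=
  (hp.integral_hasStrictDerivAt 0 s).hasDerivAt

theorem contDiff_integral {p : ℝ → ℝ} (hp : ContDiff ℝ ∞ p) :
    ContDiff ℝ ∞ (fun s => ∫ v in (0 : ℝ)..s, p v) := by
  have hd := hasDerivAt_integral hp.continuous
  rw [contDiff_infty_iff_deriv]
  refine ⟨fun s => (hd s).differentiableAt, ?_⟩
  rwa [funext fun s => (hd s).deriv]

theorem isReparam_of_pos_deriv {φ d : ℝ → ℝ} (hφ : ContDiff ℝ ∞ φ) (h0 : φ 0 = 0) (h1 : φ 1 = 1)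
    (hd : ∀ s, HasDerivAt φ (d s) s) (hpos : ∀ s, 0 < d s) : IsReparam φ d := by
  have hmono : StrictMono φ := strictMono_of_hasDerivAt_pos hd hpos
  refine ⟨hφ.contDiffOn, ⟨?_, hmono.injective.injOn, ?_⟩, h0, h1,
    fun s _ => (hd s).hasDerivWithinAt⟩
  · intro s hs
    exact ⟨h0 ▸ hmono.monotone hs.1, h1 ▸ hmono.monotone hs.2⟩
  · have := intermediate_value_Icc (zero_le_one (α := ℝ)) hφ.continuous.continuousOn
    rwa [h0, h1] at this

/-- A bounded positive vector field on the line has, after rescaling, a flow line from `0` to `1`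
in unit time. -/
theorem exists_reparam {q : ℝ → ℝ} (hq : ContDiff ℝ ∞ q) (hpos : ∀ u, 0 < q u) {C : ℝ}
    (hC : ∀ u, q u ≤ C) :
    ∃ (φ : ℝ → ℝ) (a : ℝ), 0 < a ∧ ContDiff ℝ ∞ φ ∧ φ 0 = 0 ∧ φ 1 = 1 ∧
      ∀ s, HasDerivAt φ (a * q (φ s)) s := by
  set p : ℝ → ℝ := fun u => (q u)⁻¹ with hp
  have hps : ContDiff ℝ ∞ p := hq.inv fun u => (hpos u).ne'
  have hppos : ∀ u, 0 < p u := fun u => inv_pos.2 (hpos u)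
  have hCpos : 0 < C := (hpos 0).trans_le (hC 0)
  have hpC : ∀ u, C⁻¹ ≤ p u := fun u => inv_anti₀ (hpos u) (hC u)
  set P : ℝ → ℝ := fun u => ∫ v in (0 : ℝ)..u, p v with hP
  have hPd : ∀ u, HasDerivAt P (p u) u := hasDerivAt_integral hps.continuous
  have hPs : ContDiff ℝ ∞ P := contDiff_integral hps
  have hP0 : P 0 = 0 := by simp [hP]
  have hPmono : StrictMono P := strictMono_of_hasDerivAt_pos hPd hppos
  -- `P' = 1 / q ≥ 1 / C`, so `P` grows at least linearly and is onto `ℝ`. Its inverse is therefore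
  -- a globally defined solution of `u' = q(u)`.
  have hdiff : Monotone fun u => P u - C⁻¹ * u := by
    refine monotone_of_deriv_nonneg ?_ ?_
    · exact fun u => ((hPd u).sub ((hasDerivAt_id u).const_mul C⁻¹)).differentiableAt
    · intro u
      have := ((hPd u).sub ((hasDerivAt_id u).const_mul C⁻¹)).deriv
      simp only [id, mul_one] at this
      change 0 ≤ deriv (P - fun y => C⁻¹ * y) u
      rw [this]
      exact sub_nonneg.2 (hpC u)
  have hlin : ∀ u, 0 ≤ u → C⁻¹ * u ≤ P u := fun u hu => by
    have := hdiff hu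
    simp only [hP0, mul_zero, sub_zero] at this
    linarith
  have hlin' : ∀ u, u ≤ 0 → P u ≤ C⁻¹ * u := fun u hu => by
    have := hdiff hu
    simp only [hP0, mul_zero, sub_zero] at this
    linarith
  have hCi : 0 < C⁻¹ := inv_pos.2 hCpos
  have htop : Tendsto P atTop atTop := by
    refine tendsto_atTop_mono' atTop ?_ (tendsto_id.const_mul_atTop hCi)
    filter_upwards [eventually_ge_atTop 0] with u hu using hlin u hu
  have hbot : Tendsto P atBot atBot := by
    refine tendsto_atBot_mono' atBot ?_ (tendsto_id.const_mul_atBot hCi)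
    filter_upwards [eventually_le_atBot 0] with u hu using hlin' u hu
  have hsurj : Function.Surjective P := hPs.continuous.surjective htop hbot
  set e : ℝ ≃ₜ ℝ := (hPmono.orderIsoOfSurjective P hsurj).toHomeomorph with he
  have hecoe : ∀ u, e u = P u := fun u => rfl
  have hes : ContDiff ℝ ∞ e.symm :=
    e.contDiff_symm_deriv (fun u => (hppos u).ne') hPd hPs
  have hed : ∀ s, HasDerivAt e.symm (q (e.symm s)) s := fun s => by
    have := HasDerivAt.of_local_left_inverse (f := P) (g := e.symm) (a := s)
      e.symm.continuous.continuousAt (hPd _) (hppos _).ne'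
      (Eventually.of_forall fun y => e.apply_symm_apply y)
    simpa [hp] using this
  -- The flow line from `0` reaches `1` at time `P 1`, which is thus the factor by which time is
  -- rescaled.
  refine ⟨fun s => e.symm (P 1 * s), P 1, ?_, hes.comp (contDiff_const.mul contDiff_id), ?_, ?_, ?_⟩
  · rw [← hP0]; exact hPmono zero_lt_one
  · simp only [mul_zero]
    exact e.symm_apply_eq.2 (by rw [hecoe, hP0])
  · simp only [mul_one]
    exact e.symm_apply_eq.2 (hecoe 1).symm
  · intro s
    have h2 : HasDerivAt (fun s : ℝ => P 1 * s) (P 1) s := by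
      simpa using (hasDerivAt_id s).const_mul (P 1)
    have := (hed (P 1 * s)).comp s h2
    rwa [mul_comm] at this

theorem one_div_add_pos_of_threshold_lt {E X : Type*} [NormedAddCommGroup E] [TopologicalSpace X]
    [ChartedSpace E X]
    {k : X → ℝ} {r : ℝ} (hkpos : ∀ x, 0 < k x) (hr : threshold k < r) (x : X) :
    0 < 1 / k x + r := by
  unfold threshold at hr
  have hx := hkpos x
  split_ifs at hr with hb
  · have h1 : (⨆ y, k y)⁻¹ ≤ (k x)⁻¹ := inv_anti₀ hx (le_ciSup hb x)
    rw [one_div]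
    linarith
  · have := one_div_pos.2 hx
    linarith

end Reparametrization

/-! ### The geodesic of `g₁ - k g₂` for a given end parameter. -/

section Construction

variable {E₁ : Type*} [NormedAddCommGroup E₁] [NormedSpace ℝ E₁] [FiniteDimensional ℝ E₁]
  {M₁ : Type*} [TopologicalSpace M₁] [ChartedSpace E₁ M₁] [IsManifold 𝓘(ℝ, E₁) ∞ M₁]
  {E₂ : Type*} [NormedAddCommGroup E₂] [NormedSpace ℝ E₂] [FiniteDimensional ℝ E₂]
  {M₂ : Type*} [TopologicalSpace M₂] [ChartedSpace E₂ M₂] [IsManifold 𝓘(ℝ, E₂) ∞ M₂]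
  (g₁ : ContMDiffRiemannianMetric 𝓘(ℝ, E₁) ∞ E₁ (fun x : M₁ => TangentSpace 𝓘(ℝ, E₁) x))
  (g₂ : ContMDiffRiemannianMetric 𝓘(ℝ, E₂) ∞ E₂ (fun y : M₂ => TangentSpace 𝓘(ℝ, E₂) y))
  {k : M₁ → ℝ} {r : ℝ} {μ : ℝ → M₁} {ν : ℝ → M₂}

/-- The energy is a positive factor times the squared speed, so by conservation a zero of the speed
at `0` spreads to every parameter and makes `c` constant. -/
theorem speedSq_pos_of_not_const {c : ℝ → M₁} {k : M₁ → ℝ} {r : ℝ}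
    (hk : ContMDiff 𝓘(ℝ, E₁) 𝓘(ℝ, ℝ) ∞ k) (hk0 : ∀ x, k x ≠ 0) (hf : ∀ x, 0 < 1 / k x + r)
    (hc : IsGeodesicOn 𝓘(ℝ, E₁) (metricG (ofMetric g₁) k r) c univ) {s t : ℝ} (hst : c s ≠ c t) :
    0 < speedSq g₁ c 0 := by
  have hnonneg : 0 ≤ speedSq g₁ c 0 := by
    by_cases h : (velocity 𝓘(ℝ, E₁) c univ 0 : TangentSpace 𝓘(ℝ, E₁) (c 0)) = 0
    · have : speedSq g₁ c 0 = g₁.inner (c 0) (velocity 𝓘(ℝ, E₁) c univ 0)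
        (velocity 𝓘(ℝ, E₁) c univ 0) := rfl
      rw [this, h]; simp
    · exact (g₁.pos _ _ h).le
  refine hnonneg.lt_of_ne fun h0 => hst ?_
  refine eq_of_speedSq_eq_zero g₁ hc.contMDiff (fun u => ?_) s t
  have := energy_eq g₁ hk hk0 hc u 0
  rw [← h0, mul_zero] at this
  exact (mul_eq_zero.1 this).resolve_left (hf _).ne'

/-- The Riemannian geodesic obtained from the geodesic `s ↦ (μ (t s), ν (β s))`, for the value of
`β` that makes it possible. -/
theorem exists_isRiemannianGeodesicFrom (hk : ContMDiff 𝓘(ℝ, E₁) 𝓘(ℝ, ℝ) ∞ k)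
    (hkpos : ∀ x, 0 < k x) (hf : ∀ x, 0 < 1 / k x + r) {C : ℝ} (hC : ∀ x, 1 / k x + r ≤ C)
    (hμ : IsGeodesicOn 𝓘(ℝ, E₁) (metricG (ofMetric g₁) k r) μ univ)
    (hν : IsGeodesicOn 𝓘(ℝ, E₂) (ofMetric g₂) ν univ) {ρ : ℝ}
    (hρ : ρ ^ 2 * speedSq g₂ ν 0 = (1 / k (μ 0) + r) * speedSq g₁ μ 0) (t : ℝ) :
    ∃ (γ : ℝ → M₁) (τ : ℝ → M₂),
      IsRiemannianGeodesicFrom (ofMetric g₁) k (ofMetric g₂) r (fun s => μ (t * s))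
        (fun s => ν ((ρ * ∫ u in (0 : ℝ)..t, (1 + r * k (μ u))⁻¹) * s)) γ τ ∧
      γ 0 = μ 0 ∧ τ 0 = ν 0 ∧ γ 1 = μ t ∧
      τ 1 = ν (ρ * ∫ u in (0 : ℝ)..t, (1 + r * k (μ u))⁻¹) := by
  set β : ℝ := ρ * ∫ u in (0 : ℝ)..t, (1 + r * k (μ u))⁻¹ with hβ
  have hk0 : ∀ x, k x ≠ 0 := fun x => (hkpos x).ne'
  have hfk : ∀ x, (1 + r * k x) / k x = 1 / k x + r := fun x => by
    have := hk0 x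
    field_simp
  have hfk' : ∀ x, 0 < 1 + r * k x := fun x => by
    have h := mul_pos (hf x) (hkpos x)
    have := hk0 x
    have e : (1 / k x + r) * k x = 1 + r * k x := by field_simp
    rwa [e] at h
  have hlin : ∀ a : ℝ, ContDiff ℝ ∞ (fun s : ℝ => a * s) := fun a => contDiff_const.mul contDiff_id
  have hkμ : ContDiff ℝ ∞ (fun u => k (μ u)) :=
    contMDiff_iff_contDiff.1 (hk.comp hμ.contMDiff)
  have hfμ : ContDiff ℝ ∞ (fun u => 1 / k (μ u) + r) :=
    contMDiff_iff_contDiff.1 ((contMDiff_conformalFactor hk hk0).comp hμ.contMDiff)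
  obtain ⟨φ, a, ha, hφ, hφ0, hφ1, hφd⟩ := exists_reparam
    (q := fun u => 1 / k (μ (t * u)) + r) (hfμ.comp (hlin t)) (fun u => hf _) (fun u => hC _)
  have hΦ : ContDiff ℝ ∞ (fun s => t * φ s) := contDiff_const.mul hφ
  set p : ℝ → ℝ := fun s => (k (μ (t * φ s)))⁻¹ with hp
  have hps : ContDiff ℝ ∞ p := (hkμ.comp hΦ).inv fun s => hk0 _
  have hppos : ∀ s, 0 < p s := fun s => inv_pos.2 (hkpos _)
  set I : ℝ := ∫ v in (0 : ℝ)..1, p v with hI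
  have hIpos : 0 < I := intervalIntegral.intervalIntegral_pos_of_pos
    (hps.continuous.intervalIntegrable _ _) hppos zero_lt_one
  set b : ℝ := I⁻¹ with hb
  set ψ : ℝ → ℝ := fun s => b * ∫ v in (0 : ℝ)..s, p v with hψ
  have hψs : ContDiff ℝ ∞ ψ := contDiff_const.mul (contDiff_integral hps)
  have hψd : ∀ s, HasDerivAt ψ (b / k (μ (t * φ s))) s := fun s => by
    rw [div_eq_mul_inv]
    exact (hasDerivAt_integral hps.continuous s).const_mul b
  have hbpos : 0 < b := inv_pos.2 hIpos
  have hψ0 : ψ 0 = 0 := by simp [hψ]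
  have hψ1 : ψ 1 = 1 := inv_mul_cancel₀ hIpos.ne'
  have hhc : Continuous fun u => (1 + r * k (μ u))⁻¹ :=
    (continuous_const.add (continuous_const.mul hkμ.continuous)).inv₀ fun u => (hfk' _).ne'
  -- Substitute `u = φ(s)`: since `φ' = a (1 + r k) / k`, the density `a / k` in `s` becomes `1 / (1
  -- + r k)` in `u`.
  have hsubst : a * I = ∫ u in (0 : ℝ)..1, (1 + r * k (μ (t * u)))⁻¹ := by
    have h := intervalIntegral.integral_comp_mul_deriv (a := 0) (b := 1) (f := φ)
      (f' := fun s => a * (1 / k (μ (t * φ s)) + r)) (g := fun u => (1 + r * k (μ (t * u)))⁻¹)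
      (fun s _ => hφd s)
      (continuous_const.mul (hfμ.comp hΦ).continuous).continuousOn
      (hhc.comp (hlin t).continuous)
    rw [hφ0, hφ1] at h
    rw [← h, hI, ← intervalIntegral.integral_const_mul]
    congr 1
    funext s
    have h1 := hk0 (μ (t * φ s))
    have h2 := (hfk' (μ (t * φ s))).ne'
    simp only [hp, Function.comp, ← hfk]
    generalize 1 + r * k (μ (t * φ s)) = D at h2 ⊢
    field_simp
  -- Keeping `t` as a factor avoids dividing by it, so `t = 0` needs no separate treatment.
  have hscale : t * (a * I) = ∫ u in (0 : ℝ)..t, (1 + r * k (μ u))⁻¹ := by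
    rw [hsubst]
    have := intervalIntegral.mul_integral_comp_mul_left (a := 0) (b := 1) (c := t)
      (f := fun u => (1 + r * k (μ u))⁻¹)
    simpa using this
  -- This identity dictates `β`: it says `B = ρ A`, which together with `hρ` is the energy
  -- condition.
  have hβb : β * b = ρ * (t * a) := by
    rw [hβ, ← hscale, hb]
    have := hIpos.ne'
    field_simp
  have hγ : ContMDiff 𝓘(ℝ, ℝ) 𝓘(ℝ, E₁) ∞ (fun s => μ (t * s)) :=
    hμ.contMDiff.comp (hlin t).contMDiff
  have hτ : ContMDiff 𝓘(ℝ, ℝ) 𝓘(ℝ, E₂) ∞ (fun s => ν (β * s)) :=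
    hν.contMDiff.comp (hlin β).contMDiff
  have hS : UniqueDiffOn ℝ (Icc (0 : ℝ) 1) := uniqueDiffOn_Icc zero_lt_one
  have h0mem : (0 : ℝ) ∈ Icc (0 : ℝ) 1 := ⟨le_rfl, zero_le_one⟩
  have hd : ∀ a : ℝ, deriv (fun s : ℝ => a * s) 0 = a := fun a => by simp
  refine ⟨fun s => μ (t * φ s), fun s => ν (β * ψ s),
    ⟨isGeodesicOn_metricSum g₁ g₂ hk hk0 hμ hν t β hS, φ, ψ, a, b, ?_, ?_, fun s _ => rfl,
      fun s _ => rfl, ?_, ?_⟩, ?_, ?_, ?_, ?_⟩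
  · simp only [hfk]
    exact isReparam_of_pos_deriv hφ hφ0 hφ1 hφd fun s => mul_pos ha (hf _)
  · exact isReparam_of_pos_deriv hψs hψ0 hψ1 hψd fun s => div_pos hbpos (hkpos _)
  · rw [ofMetric_velocity g₁ hγ hS h0mem, ofMetric_velocity g₂ hτ hS h0mem,
      speedSq_comp g₁ hμ.contMDiff (hlin t), speedSq_comp g₂ hν.contMDiff (hlin β), hd, hd,
      hfk]
    simp only [mul_zero]
    -- The last term factors the difference of squares `(β b)² - (ρ t a)²`.
    linear_combination -(t * a) ^ 2 * hρ - (β * b + ρ * (t * a)) * speedSq g₂ ν 0 * hβb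
  · refine isGeodesicOn_metricWarped g₁ g₂ hk hk0 hμ hν (Φ := fun s => t * φ s)
      (Ψ := fun s => β * ψ s) hΦ (contDiff_const.mul hψs) (A := t * a) (B := β * b) ?_ ?_ ?_ hS
    · intro s
      rw [((hφd s).const_mul t).deriv, mul_assoc]
    · intro s
      rw [((hψd s).const_mul β).deriv, mul_div_assoc]
    · linear_combination -(t * a) ^ 2 * hρ - (β * b + ρ * (t * a)) * speedSq g₂ ν 0 * hβb
  · simp only [hφ0, mul_zero]
  · simp only [hψ0, mul_zero]
  · simp only [hφ1, mul_one]
  · simp only [hψ1, mul_one]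

end Construction

end RiemGeod

/-! ### The map `θ` and its properties. -/

theorem theorem4p6
    {E₁ : Type*} [NormedAddCommGroup E₁] [NormedSpace ℝ E₁] [FiniteDimensional ℝ E₁]
    {M₁ : Type*} [TopologicalSpace M₁] [ChartedSpace E₁ M₁] [IsManifold 𝓘(ℝ, E₁) ∞ M₁]
    {E₂ : Type*} [NormedAddCommGroup E₂] [NormedSpace ℝ E₂] [FiniteDimensional ℝ E₂]
    {M₂ : Type*} [TopologicalSpace M₂] [ChartedSpace E₂ M₂] [IsManifold 𝓘(ℝ, E₂) ∞ M₂]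
    (g₁ : ContMDiffRiemannianMetric 𝓘(ℝ, E₁) ∞ E₁ (fun x : M₁ => TangentSpace 𝓘(ℝ, E₁) x))
    (g₂ : ContMDiffRiemannianMetric 𝓘(ℝ, E₂) ∞ E₂ (fun y : M₂ => TangentSpace 𝓘(ℝ, E₂) y))
    (k : M₁ → ℝ) (hk : ContMDiff 𝓘(ℝ, E₁) 𝓘(ℝ, ℝ) ∞ k)
    (hk₀ : ∃ k₀ : ℝ, 0 < k₀ ∧ ∀ x, k₀ ≤ k x)
    (r : ℝ) (hr : RiemGeod.threshold k < r)
    (μ : ℝ → M₁)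
    (hμ : RiemGeod.IsGeodesicOn 𝓘(ℝ, E₁) (RiemGeod.metricG (RiemGeod.ofMetric g₁) k r) μ univ)
    (hμinj : InjOn μ (Ici 0))
    (ν : ℝ → M₂) (hν : RiemGeod.IsGeodesicOn 𝓘(ℝ, E₂) (RiemGeod.ofMetric g₂) ν univ)
    (hνconst : ∃ s t : ℝ, ν s ≠ ν t) :
    ∃ θ : (μ '' Ici (0 : ℝ)) → (ν '' Ici (0 : ℝ)),
      (∀ (t : ℝ) (ht : t ∈ Ici (0 : ℝ)), ∃ β : ℝ, 0 ≤ β ∧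
        ∃ (γ : ℝ → M₁) (τ : ℝ → M₂),
          RiemGeod.IsRiemannianGeodesicFrom (RiemGeod.ofMetric g₁) k (RiemGeod.ofMetric g₂) r
            (fun s => μ (t * s)) (fun s => ν (β * s)) γ τ ∧
          (γ 0, τ 0) = (μ 0, ν 0) ∧
          (γ 1, τ 1) = (μ t, (θ ⟨μ t, mem_image_of_mem μ ht⟩ : M₂))) ∧
      (BddAbove (range k) → Function.Surjective θ) ∧
      (InjOn ν (Ici 0) → Function.Injective θ) := by
  obtain ⟨k₀, hk₀pos, hk₀⟩ := hk₀
  have hkpos : ∀ x, 0 < k x := fun x => hk₀pos.trans_le (hk₀ x)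
  have hk0 : ∀ x, k x ≠ 0 := fun x => (hkpos x).ne'
  have hf := RiemGeod.one_div_add_pos_of_threshold_lt (E := E₁) hkpos hr
  -- The positive lower bound of `k` bounds the field `1 / k + r` from above, as the global flow in
  -- `exists_reparam` requires.
  have hC : ∀ x, 1 / k x + r ≤ 1 / k₀ + r := fun x =>
    add_le_add_left (one_div_le_one_div_of_le hk₀pos (hk₀ x)) r
  have hc : 0 < RiemGeod.speedSq g₁ μ 0 := by
    refine RiemGeod.speedSq_pos_of_not_const g₁ hk hk0 hf hμ (s := 0) (t := 1) fun h => ?_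
    exact zero_ne_one (hμinj (mem_Ici.2 le_rfl) (mem_Ici.2 zero_le_one) h)
  have hd : 0 < RiemGeod.speedSq g₂ ν 0 := by
    obtain ⟨s, t, hst⟩ := hνconst
    exact RiemGeod.speedSq_pos_of_not_const g₂ (k := fun _ => 1) (r := 0) contMDiff_const
      (fun _ => one_ne_zero) (fun _ => by norm_num) (by rwa [RiemGeod.metricG_one]) hst
  set ρ : ℝ := Real.sqrt ((1 / k (μ 0) + r) * RiemGeod.speedSq g₁ μ 0 / RiemGeod.speedSq g₂ ν 0)
    with hρdef
  have hquot : 0 < (1 / k (μ 0) + r) * RiemGeod.speedSq g₁ μ 0 / RiemGeod.speedSq g₂ ν 0 :=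
    div_pos (mul_pos (hf _) hc) hd
  have hρpos : 0 < ρ := Real.sqrt_pos.2 hquot
  have hρ : ρ ^ 2 * RiemGeod.speedSq g₂ ν 0 = (1 / k (μ 0) + r) * RiemGeod.speedSq g₁ μ 0 := by
    rw [hρdef, Real.sq_sqrt hquot.le, div_mul_cancel₀ _ hd.ne']
  have hD : ∀ x, 0 < 1 + r * k x := fun x => by
    have h := mul_pos (hf x) (hkpos x)
    have h' := hk0 x
    have e : (1 / k x + r) * k x = 1 + r * k x := by field_simp
    rwa [e] at h
  have hcont : Continuous fun u => (1 + r * k (μ u))⁻¹ :=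
    (continuous_const.add (continuous_const.mul (hk.continuous.comp hμ.contMDiff.continuous))).inv₀
      fun u => (hD _).ne'
  set β : ℝ → ℝ := fun t => ρ * ∫ u in (0 : ℝ)..t, (1 + r * k (μ u))⁻¹ with hβ
  have hβd : ∀ t, HasDerivAt β (ρ * (1 + r * k (μ t))⁻¹) t := fun t =>
    (RiemGeod.hasDerivAt_integral hcont t).const_mul ρ
  have hβmono : StrictMono β :=
    strictMono_of_hasDerivAt_pos hβd fun t => mul_pos hρpos (inv_pos.2 (hD _))
  have hβ0 : β 0 = 0 := by simp [hβ]
  have hβnn : ∀ t, 0 ≤ t → 0 ≤ β t := fun t ht => hβ0 ▸ hβmono.monotone ht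
  -- `T` selects a parameter of each point of the ray; injectivity of `μ` makes it the only one, so
  -- `θ = ν ∘ β ∘ T` satisfies `θ(μ t) = ν(β t)`.
  choose T hT0 hTμ using fun y : μ '' Ici (0 : ℝ) => y.2
  have hTeq : ∀ (t : ℝ) (ht : t ∈ Ici (0 : ℝ)), T ⟨μ t, mem_image_of_mem μ ht⟩ = t := fun t ht =>
    hμinj (hT0 _) ht (hTμ _)
  refine ⟨fun y => ⟨ν (β (T y)), mem_image_of_mem ν (hβnn _ (hT0 y))⟩, ?_, ?_, ?_⟩
  · intro t ht
    obtain ⟨γ, τ, hgeo, h0, h0', h1, h1'⟩ :=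
      RiemGeod.exists_isRiemannianGeodesicFrom g₁ g₂ hk hkpos hf hC hμ hν hρ t
    refine ⟨β t, hβnn t ht, γ, τ, hgeo, by rw [h0, h0'], ?_⟩
    simp only [hTeq t ht]
    rw [h1, h1']
  · rintro ⟨K, hK⟩ ⟨_, s, hs, rfl⟩
    -- The absolute value covers negative `r`, which the threshold allows when `k` is bounded above.
    have hKpos : 0 < 1 + |r| * K := by
      have : 0 < K := (hkpos (μ 0)).trans_le (hK (mem_range_self _))
      positivity
    have hbound : ∀ u, (1 + |r| * K)⁻¹ ≤ (1 + r * k (μ u))⁻¹ := fun u => by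
      refine inv_anti₀ (hD _) (add_le_add_right ?_ 1)
      exact mul_le_mul (le_abs_self r) (hK (mem_range_self _)) (hkpos _).le (abs_nonneg r)
    obtain ⟨t, ht0, hst⟩ : ∃ t, 0 ≤ t ∧ s ≤ β t := by
      -- This `t` solves `ρ t / (1 + |r| K) = s`, where the left side is the lower bound for `β t`
      -- obtained by integrating `hbound`.
      refine ⟨s / ρ * (1 + |r| * K), mul_nonneg (div_nonneg hs hρpos.le) hKpos.le, ?_⟩
      set t := s / ρ * (1 + |r| * K) with htdef
      have ht0 : 0 ≤ t := mul_nonneg (div_nonneg hs hρpos.le) hKpos.le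
      have h := intervalIntegral.integral_mono_on ht0
        (continuous_const.intervalIntegrable (μ := MeasureTheory.volume) 0 t)
        (hcont.intervalIntegrable 0 t) fun u _ => hbound u
      rw [intervalIntegral.integral_const, sub_zero, smul_eq_mul, htdef,
        mul_inv_cancel_right₀ hKpos.ne'] at h
      calc s = ρ * (s / ρ) := by field_simp
        _ ≤ β t := mul_le_mul_of_nonneg_left h hρpos.le
    have hβc : Continuous β := continuous_iff_continuousAt.2 fun t => (hβd t).continuousAt
    obtain ⟨u, hu, hus⟩ := intermediate_value_Icc ht0 hβc.continuousOn
      (show s ∈ Icc (β 0) (β t) from ⟨hβ0.symm ▸ hs, hst⟩)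
    refine ⟨⟨μ u, mem_image_of_mem μ hu.1⟩, Subtype.ext ?_⟩
    simp only [hTeq u hu.1, hus]
  · intro hνinj y y' h
    have h1 := hνinj (hβnn _ (hT0 y)) (hβnn _ (hT0 y')) (Subtype.ext_iff.1 h)
    have h2 := hβmono.injective h1
    refine Subtype.ext ?_
    rw [← hTμ y, ← hTμ y', h2]
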